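/- Let $w\neq 0$ be an algebraic number, let $K=\mathbb{Q}(w)$ be the number field generated by it, with ring of integers $\mathcal{O}$, and let $v_{\mathfrak p}$ be the normalized valuation of a nonzero prime ideal $\mathfrak p\subset\mathcal{O}$, with local ring $\mathcal{O}_{\mathfrak p}=\{x\in K\mid v_{\mathfrak p}(x)\ge 0\}$ and a fixed element $\pi_{\mathfrak p}$ with $v_{\mathfrak p}(\pi_{\mathfrak p})=1$. Let $M_w$ be the finite set of nonzero primes $\mathfrak p$ with $v_{\mathfrak p}(w)\neq 0$, and let $\mathcal{O}_w=\{x\in K\mid v_{\mathfrak p}(x)\ge 0 \text{ for all nonzero primes } \mathfrak p\notin M_w\}$, with unit group $\mathcal{O}_w^\times$ acting on $\mathcal{O}_w$ by multiplication. Fix $e_1,\dots,e_{n_w}\in\mathcal{O}^\times$ forming a $\mathbb{Z}$-basis of a free abelian subgroup $\mathbb{Z}^{n_w}$ such that $\mathcal{O}^\times$ is the direct product of its (finite cyclic) torsion subgroup and this $\mathbb{Z}^{n_w}$. Fix a homomorphism $\alpha_w\colon\mathcal{O}_w^\times\to\mathbb{Z}^{n_w}$ that is the identity on $\mathbb{Z}^{n_w}$,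 and for each $\mathfrak p\in M_w$ an element $y_{\mathfrak p}\in\mathcal{O}$ that generates a positive power of $\mathfrak p$. Let $T(v_{\mathfrak p})$ be the Bruhat–Tits tree: its vertices are the classes, up to scaling by $K^\times$, of the lattices in $K\oplus K$ (finitely generated $\mathcal{O}_{\mathfrak p}$-submodules spanning $K\oplus K$); two classes are adjacent if and only if they have representatives $L_1,L_2$ with bases $(b_1,b_2)$ and $(\pi_{\mathfrak p}^{a_1}b_1,\pi_{\mathfrak p}^{a_2}b_2)$, where $a_1,a_2\in\mathbb{Z}$ and $|a_1-a_2|=1$. It carries the path metric with edges of length $1$, and $f_{\mathfrak p}(q)=\lim_{n\to\infty}\bigl(n-d(q,[\pi_{\mathfrak p}^{-n}\mathcal{O}_{\mathfrak p}\oplus\mathcal{O}_{\mathfrak p}])\bigr)$ is its Busemann function. Put $X_w=\mathbb{R}^{n_w}\times\prod_{\mathfrak p\in M_w}T(v_{\mathfrak p})$ with the $\ell^2$ product metric. For an embedding $\tau\colon K\to\mathbb{C}$ put $[\tau]=\{\tau,\overline\tau\}$, let $K_{\mathbb{R},[\tau]}$ be the set of $z\in\prod_{\tau'\in[\tau]}\mathbb{C}$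 with $z_{\overline{\tau'}}=\overline{z_{\tau'}}$ for all $\tau'\in[\tau]$, with the Euclidean metric (so that $\prod_{[\tau]}K_{\mathbb{R},[\tau]}$ is the Minkowski space of $K$), and let $$f^{[\tau]}\bigl(r,(q_{\mathfrak p})_{\mathfrak p}\bigr)=\prod_{i=1}^{n_w}|\tau(e_i)|^{-r_i}\cdot\prod_{\mathfrak p\in M_w}|\tau(y_{\mathfrak p})|^{f_{\mathfrak p}(q_{\mathfrak p})/v_{\mathfrak p}(y_{\mathfrak p})},\qquad (r,(q_{\mathfrak p})_{\mathfrak p})\in X_w .$$ For metric spaces $M,N$ and a continuous function $f\colon M\to(0,\infty)$, the warped product $M\times_f N$ is $M\times N$ with the distance of two points defined as the infimum of the lengths of the paths $\gamma=(\gamma_M,\gamma_N)\colon[0,1]\to M\times N$ between them, where the length of $\gamma$ is the limit, over the partitions $0=t_0<\dots<t_n=1$ directed by refinement, of $$\sum_{i=1}^n\sqrt{d_M(\gamma_M(t_{i-1}),\gamma_M(t_i))^2+f(\gamma_M(t_{i-1}))^2\,d_N(\gamma_N(t_{i-1}),\gamma_N(t_i))^2}\,.$$ Let $Y_w$ be the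 set of those points $(x_{[\tau]},z_{[\tau]})_{[\tau]}$ of $\prod_{[\tau]}X_w\times_{f^{[\tau]}}K_{\mathbb{R},[\tau]}$ for which all $x_{[\tau]}$ coincide, with the $\ell^2$ product metric of the warped products. The group $\mathcal{O}_w\rtimes\mathcal{O}_w^\times$ acts on $Y_w$: the element $(x,y)$ acts on $\mathbb{R}^{n_w}$ as the translation by $\alpha_w(y)$, on $T(v_{\mathfrak p})$ through the matrix $\begin{pmatrix}y&x\\0&1\end{pmatrix}\in\mathrm{GL}_2(K)$, and on $K_{\mathbb{R},[\tau]}$ by $(z_{\tau'})_{\tau'}\mapsto(\tau'(y)z_{\tau'}+\tau'(x))_{\tau'}$. Then this action is cocompact and proper: 1. there is a compact subset $C\subset Y_w$ with $(\mathcal{O}_w\rtimes\mathcal{O}_w^\times)\cdot C=Y_w$; 2. for all compact subsets $C_1,C_2\subset Y_w$ the set $\{g\in\mathcal{O}_w\rtimes\mathcal{O}_w^\times\mid C_1\cap gC_2\neq\emptyset\}$ is finite. -/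

import Mathlib

open NumberField IsDedekindDomain
open scoped ENNReal Pointwise unitInterval IntermediateField

noncomputable section

namespace WarpedAction

/-! ### Geometric realization of a graph, with its path metric -/

section GeometricRealization

variable {V : Type*}

/-- A point of the geometric realization of a graph, in barycentric coordinates: the point
`(1 - t) u + t v` of the closed edge from `u` to `v` (or a vertex, if `u = v`). -/
structure Realization (G : SimpleGraph V) where
  coord : V →₀ ℝ
  mem_edge : ∃ (u v : V) (t : ℝ), t ∈ Set.Icc (0 : ℝ) 1 ∧ (u = v ∨ G.Adj u v) ∧
    coord = Finsupp.single u (1 - t) + Finsupp.single v t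

namespace Realization

variable {G : SimpleGraph V}

@[ext] theorem ext {p q : Realization G} (h : p.coord = q.coord) : p = q := by
  cases p; cases q; cases h; rfl

/-- The vertex `v` as a point of the geometric realization. -/
def vertex (G : SimpleGraph V) (v : V) : Realization G :=
  ⟨Finsupp.single v 1, v, v, 0, by simp, Or.inl rfl, by simp⟩

/-- `OnEdge p q r`: the points `p` and `q` lie on a common closed edge, which is identified with
the interval `[0, 1]`, and their distance in this interval is `r`. -/
def OnEdge (p q : Realization G) (r : ℝ) : Prop :=
  ∃ (u v : V) (s t : ℝ), s ∈ Set.Icc (0 : ℝ) 1 ∧ t ∈ Set.Icc (0 : ℝ) 1 ∧ G.Adj u v ∧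
    p.coord = Finsupp.single u (1 - s) + Finsupp.single v s ∧
    q.coord = Finsupp.single u (1 - t) + Finsupp.single v t ∧ r = |s - t|

/-- `Chain p q r`: there is a piecewise linear path of length `r` from `p` to `q`. -/
inductive Chain : Realization G → Realization G → ℝ → Prop
  | refl (p : Realization G) : Chain p p 0
  | step {p q q' : Realization G} {r s : ℝ} : Chain p q r → OnEdge q q' s → Chain p q' (r + s)

theorem OnEdge.symm {p q : Realization G} {r : ℝ} (h : OnEdge p q r) : OnEdge q p r := by
  obtain ⟨u, v, s, t, hs, ht, ha, hp, hq, hr⟩ := h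
  exact ⟨u, v, t, s, ht, hs, ha, hq, hp, by rw [hr, abs_sub_comm]⟩

theorem OnEdge.nonneg {p q : Realization G} {r : ℝ} (h : OnEdge p q r) : 0 ≤ r := by
  obtain ⟨u, v, s, t, hs, ht, ha, hp, hq, hr⟩ := h
  rw [hr]; exact abs_nonneg _

theorem Chain.nonneg {p q : Realization G} {r : ℝ} (h : Chain p q r) : 0 ≤ r := by
  induction h with
  | refl => exact le_rfl
  | step _ h2 ih => exact add_nonneg ih h2.nonneg

theorem Chain.trans {p q q' : Realization G} {r s : ℝ} (h : Chain p q r) (h' : Chain q q' s) :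
    Chain p q' (r + s) := by
  induction h' with
  | refl => simpa using h
  | step _ h2 ih => rw [← add_assoc]; exact ih.step h2

theorem Chain.symm {p q : Realization G} {r : ℝ} (h : Chain p q r) : Chain q p r := by
  induction h with
  | refl => exact Chain.refl _
  | @step q q' r s _ h2 ih =>
    have h3 : Chain q' q (0 + s) := (Chain.refl q').step h2.symm
    have := h3.trans ih
    rwa [zero_add, add_comm] at this

/-- The path metric: `edist p q` is the infimum of the lengths of the piecewise linear paths
from `p` to `q`. -/
instance : PseudoEMetricSpace (Realization G) where
  edist p q := ⨅ (r : ℝ) (_ : Chain p q r), ENNReal.ofReal r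
  edist_self p := by
    refine le_antisymm ?_ bot_le
    exact (iInf₂_le 0 (Chain.refl p)).trans (by simp)
  edist_comm p q := by
    refine le_antisymm ?_ ?_ <;>
    exact le_iInf₂ fun r h => iInf₂_le r h.symm
  edist_triangle p q q' := by
    simp only [ENNReal.iInf_add, ENNReal.add_iInf]
    refine le_iInf₂ fun r h => le_iInf₂ fun s h' => ?_
    refine (iInf₂_le (s + r) (h'.trans h)).trans ?_
    rw [ENNReal.ofReal_add h'.nonneg h.nonneg]

/-- The automorphism group of a graph acts on its geometric realization. -/
instance : MulAction (G ≃g G) (Realization G) where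
  smul φ p := ⟨p.coord.mapDomain φ, by
    obtain ⟨u, v, t, ht, huv, hp⟩ := p.mem_edge
    refine ⟨φ u, φ v, t, ht, huv.imp (congrArg φ) φ.map_adj_iff.2, ?_⟩
    rw [hp, Finsupp.mapDomain_add, Finsupp.mapDomain_single, Finsupp.mapDomain_single]⟩
  one_smul p := Realization.ext (Finsupp.mapDomain_id)
  mul_smul φ ψ p := Realization.ext (Finsupp.mapDomain_comp (f := ψ) (g := φ))

end Realization

end GeometricRealization

/-! ### Warped products -/

section Warped

variable {M N : Type*} [PseudoEMetricSpace M] [PseudoEMetricSpace N]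

/-- The sum over the consecutive points of a list `t₀, t₁, …, tₙ` of the quantities
`√(d_M(γ_M(tᵢ₋₁), γ_M(tᵢ))² + f(γ_M(tᵢ₋₁))² d_N(γ_N(tᵢ₋₁), γ_N(tᵢ))²)`. -/
def warpedSum (f : M → ℝ) (γ : I → M × N) : List I → ℝ≥0∞
  | s :: t :: l =>
      (edist (γ s).1 (γ t).1 ^ 2 +
        ENNReal.ofReal (f (γ s).1) ^ 2 * edist (γ s).2 (γ t).2 ^ 2) ^ (1 / 2 : ℝ) +
      warpedSum f γ (t :: l)
  | _ => 0

/-- The length of a path in the warped product `M ×_f N`: the limit of the sums above over the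
partitions `0 = t₀ < ⋯ < tₙ = 1`, directed by refinement. (If `f` is continuous and positive, then
the limit exists in `[0, ∞]`; it is written as an upper limit here.) A partition is given as
`s ∪ {0, 1}` with `s` a finite set. -/
def warpedLength (f : M → ℝ) (γ : I → M × N) : ℝ≥0∞ :=
  Filter.limsup
    (fun s : Finset I => warpedSum f γ (Finset.sort (insert 0 (insert 1 s)) (· ≤ ·)))
    Filter.atTop

/-- The distance of the warped product `M ×_f N`: the infimum of the lengths of the paths from
`a` to `b`. -/
def warpedEDist (f : M → ℝ) (a b : M × N) : ℝ≥0∞ :=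
  ⨅ γ : Path a b, warpedLength f γ

end Warped

/-! ### The Bruhat–Tits tree of a finite place -/

section Scalar

variable {K : Type*} [Field K]

/-- Multiplication with the scalar `x`. -/
def scalar (x : Kˣ) : (K × K) ≃ₗ[K] (K × K) := LinearEquiv.smulOfUnit x

theorem scalar_apply (x : Kˣ) (z : K × K) : scalar x z = (x * z.1, x * z.2) := rfl

theorem scalar_comm (φ : (K × K) ≃ₗ[K] (K × K)) (x : Kˣ) : φ * scalar x = scalar x * φ := by
  apply LinearEquiv.ext
  intro z
  change φ (x • z) = x • φ z
  simp [Units.smul_def]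

end Scalar

section Tree

variable {K : Type*} [Field K] [NumberField K] (p : HeightOneSpectrum (𝓞 K))

/-- The normalized valuation `v_𝔭 : Kˣ → ℤ` (with junk value `0` at `0`). -/
def ord (x : K) : ℤ := -(p.valuation K x).log

/-- The local ring `𝒪_𝔭 = {x ∈ K | v_𝔭(x) ≥ 0}`. -/
abbrev LocalRing : ValuationSubring K := (p.valuation K).valuationSubring

/-- A fixed element `π_𝔭` of `K` with `v_𝔭(π_𝔭) = 1`. -/
def unif : K := (p.valuation_exists_uniformizer K).choose

/-- Lattices: finitely generated `𝒪_𝔭`-submodules of `K ⊕ K` that span the `K`-vector space. -/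
def Lattice : Type _ :=
  {L : Submodule (LocalRing p) (K × K) // L.FG ∧ Submodule.span K (L : Set (K × K)) = ⊤}

/-- The image of a lattice under a `K`-linear automorphism of `K ⊕ K`. -/
def Lattice.map (φ : (K × K) ≃ₗ[K] (K × K)) (L : Lattice p) : Lattice p :=
  ⟨L.1.map (φ.toLinearMap.restrictScalars (LocalRing p)), L.2.1.map _, by
    have h : ((L.1.map (φ.toLinearMap.restrictScalars (LocalRing p)) :
        Submodule (LocalRing p) (K × K)) : Set (K × K)) = φ.toLinearMap '' (L.1 : Set (K × K)) :=
      rfl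
    rw [h, Submodule.span_image, L.2.2, Submodule.map_top, LinearMap.range_eq_top]
    exact φ.surjective⟩

/-- `GL(K ⊕ K)` acts on the set of lattices. -/
instance : MulAction ((K × K) ≃ₗ[K] (K × K)) (Lattice p) where
  smul φ L := L.map p φ
  one_smul _ := Subtype.ext (Submodule.map_id _)
  mul_smul φ ψ L := Subtype.ext (Submodule.map_comp
    (ψ.toLinearMap.restrictScalars (LocalRing p))
    (φ.toLinearMap.restrictScalars (LocalRing p)) L.1)

/-- Two lattices `L₁`, `L₂` are equivalent if and only if `L₁ = x L₂` for some `x ∈ Kˣ`. -/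
instance latticeSetoid : Setoid (Lattice p) where
  r L₁ L₂ := ∃ x : Kˣ, L₁ = scalar x • L₂
  iseqv :=
    { refl := fun L => ⟨1, by
        have : scalar (1 : Kˣ) = 1 := by ext <;> simp [scalar_apply]
        rw [this, one_smul]⟩
      symm := by
        rintro L₁ L₂ ⟨x, rfl⟩
        refine ⟨x⁻¹, ?_⟩
        have : scalar x⁻¹ * scalar x = 1 := by
          ext <;> simp [scalar_apply]
        rw [smul_smul, this, one_smul]
      trans := by
        rintro L₁ L₂ L₃ ⟨x, rfl⟩ ⟨y, rfl⟩
        refine ⟨x * y, ?_⟩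
        have : scalar (x * y) = scalar x * scalar y := by
          ext <;> simp [scalar_apply, mul_assoc]
        rw [this, mul_smul] }

/-- The lattice classes. -/
def LatticeClass : Type _ := Quotient (latticeSetoid p)

variable {p} in
/-- `L₁` has a basis `(e₁, e₂)` such that `(π^{a₁} e₁, π^{a₂} e₂)` is a basis for `L₂`, for
integers `a₁`, `a₂` with `|a₁ - a₂| = n`. -/
def IsDist (L₁ L₂ : Lattice p) (n : ℤ) : Prop :=
  ∃ (b₁ : Module.Basis (Fin 2) (LocalRing p) L₁.1) (b₂ : Module.Basis (Fin 2) (LocalRing p) L₂.1)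
    (a : Fin 2 → ℤ), (∀ i, (b₂ i : K × K) = unif p ^ a i • (b₁ i : K × K)) ∧ |a 0 - a 1| = n

/-- The graph `T(v_𝔭)`: the vertices are the lattice classes, and two classes are adjacent if and
only if their distance is `1`. (This relation is symmetric and irreflexive.) -/
def treeGraph : SimpleGraph (LatticeClass p) :=
  SimpleGraph.fromRel fun c₁ c₂ => ∃ L₁ L₂ : Lattice p,
    (⟦L₁⟧ : LatticeClass p) = c₁ ∧ (⟦L₂⟧ : LatticeClass p) = c₂ ∧ IsDist L₁ L₂ 1

/-- The tree `T(v_𝔭)` as a metric space. -/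
abbrev Tree : Type _ := Realization (treeGraph p)

/-- `GL(K ⊕ K)` acts on the set of lattice classes. -/
instance : MulAction ((K × K) ≃ₗ[K] (K × K)) (LatticeClass p) where
  smul φ := Quotient.map (fun L : Lattice p => φ • L) (by
    rintro L₁ L₂ ⟨x, rfl⟩
    exact ⟨x, by rw [smul_smul, scalar_comm, mul_smul]⟩)
  one_smul := by
    rintro ⟨L⟩
    exact congrArg (Quotient.mk (latticeSetoid p)) (one_smul _ L)
  mul_smul φ ψ := by
    rintro ⟨L⟩
    exact congrArg (Quotient.mk (latticeSetoid p)) (mul_smul φ ψ L)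

variable {p} in
theorem IsDist.smul (φ : (K × K) ≃ₗ[K] (K × K)) {L₁ L₂ : Lattice p} {n : ℤ}
    (h : IsDist L₁ L₂ n) : IsDist (φ • L₁) (φ • L₂) n := by
  obtain ⟨b₁, b₂, a, h, hn⟩ := h
  have inj : Function.Injective (φ.toLinearMap.restrictScalars (LocalRing p)) := φ.injective
  refine ⟨b₁.map (Submodule.equivMapOfInjective _ inj L₁.1),
    b₂.map (Submodule.equivMapOfInjective _ inj L₂.1), a, fun i => ?_, hn⟩
  have e₁ : ((b₁.map (Submodule.equivMapOfInjective _ inj L₁.1) i :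
      L₁.1.map (φ.toLinearMap.restrictScalars (LocalRing p))) : K × K) = φ (b₁ i : K × K) := rfl
  have e₂ : ((b₂.map (Submodule.equivMapOfInjective _ inj L₂.1) i :
      L₂.1.map (φ.toLinearMap.restrictScalars (LocalRing p))) : K × K) = φ (b₂ i : K × K) := rfl
  exact e₂.trans ((by rw [h i, map_smul] : _ = unif p ^ a i • φ (b₁ i : K × K)).trans
    (congrArg (unif p ^ a i • ·) e₁.symm))

theorem treeGraph_adj_smul (φ : (K × K) ≃ₗ[K] (K × K)) {c₁ c₂ : LatticeClass p}
    (h : (treeGraph p).Adj c₁ c₂) : (treeGraph p).Adj (φ • c₁) (φ • c₂) := by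
  rw [treeGraph, SimpleGraph.fromRel_adj] at h ⊢
  refine ⟨fun h' => h.1 (smul_left_cancel φ h'), h.2.imp ?_ ?_⟩ <;>
  · rintro ⟨L₁, L₂, rfl, rfl, hL⟩
    exact ⟨φ • L₁, φ • L₂, rfl, rfl, IsDist.smul φ hL⟩

/-- `GL(K ⊕ K)` acts on the graph `T(v_𝔭)` by automorphisms. -/
def treeAut : ((K × K) ≃ₗ[K] (K × K)) →* (treeGraph p ≃g treeGraph p) where
  toFun φ :=
    { toEquiv := MulAction.toPerm φ
      map_rel_iff' := by
        intro c₁ c₂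
        refine ⟨fun h => ?_, treeGraph_adj_smul p φ⟩
        simpa using treeGraph_adj_smul p φ⁻¹ h }
  map_one' := RelIso.ext fun c => one_smul ((K × K) ≃ₗ[K] (K × K)) c
  map_mul' φ ψ := RelIso.ext fun c => mul_smul φ ψ c

/-- The lattice `L_𝔭(n) = π^{-n} 𝒪_𝔭 ⊕ 𝒪_𝔭`. -/
def stdLattice (n : ℤ) : Lattice p :=
  ⟨Submodule.span (LocalRing p) {((unif p) ^ (-n), 0), (0, 1)},
    Submodule.fg_span (Set.toFinite _), by
    rw [Submodule.span_span_of_tower, eq_top_iff]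
    rintro ⟨a, b⟩ -
    have hπ : unif p ≠ 0 := p.valuation_uniformizer_ne_zero K
    rw [Submodule.mem_span_pair]
    refine ⟨a * (unif p) ^ n, b, ?_⟩
    ext <;> simp [mul_assoc, mul_inv_cancel₀ (zpow_ne_zero n hπ)]⟩

/-- The Busemann function `f_𝔭(x) = lim_{n → ∞} (n - d(x, [L_𝔭(n)]))` on the tree. -/
def busemann (x : Tree p) : ℝ :=
  Filter.limUnder Filter.atTop fun n : ℕ =>
    (n : ℝ) - (edist x (Realization.vertex (treeGraph p) ⟦stdLattice p n⟧)).toReal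

end Tree

/-! ### Components of the Minkowski space -/

section Minkowski

variable {K : Type*} [Field K] [NumberField K]

/-- The embeddings in the class `[τ] = {τ, τ̄}`. Such classes are the infinite places of `K`. -/
abbrev EmbClass (v : InfinitePlace K) : Type _ := {τ : K →+* ℂ // InfinitePlace.mk τ = v}

instance (v : InfinitePlace K) : Fintype (EmbClass v) := Fintype.ofFinite _

/-- The component of the Minkowski space with index `[τ]`: the points `z` of `∏_{τ' ∈ [τ]} ℂ` such
that the coordinate at `τ̄'` is the complex conjugate of the coordinate at `τ'`, with the restriction
of the hermitian scalar product `∑ x_τ' ȳ_τ'`. -/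
def Mink (v : InfinitePlace K) : Submodule ℝ (EuclideanSpace ℂ (EmbClass v)) where
  carrier := {z | ∀ τ τ' : EmbClass v, τ'.1 = ComplexEmbedding.conjugate τ.1 →
    z τ' = (starRingEnd ℂ) (z τ)}
  add_mem' := by
    intro a b ha hb τ τ' h
    simp [ha τ τ' h, hb τ τ' h]
  zero_mem' := by intro τ τ' _; simp
  smul_mem' := by
    intro c a ha τ τ' h
    simp [ha τ τ' h]

/-- The affine map `z ↦ (τ(y) z_τ + τ(x))_τ` of the component of the Minkowski space. -/
def Mink.affine {v : InfinitePlace K} (x y : K) (z : Mink v) : Mink v :=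
  ⟨WithLp.toLp 2 fun τ => τ.1 y * z.1 τ + τ.1 x, by
    intro τ τ' h
    simp [z.2 τ τ' h, h, ComplexEmbedding.conjugate_coe_eq]⟩

end Minkowski

/-! ### The group -/

section Group

variable {K : Type*} [Field K] [NumberField K] (w : Kˣ)

/-- The set `M_w` of the (nonzero) prime ideals `𝔭` with `v_𝔭(w) ≠ 0`. -/
def primes : Set (HeightOneSpectrum (𝓞 K)) := {p | p.valuation K (w : K) ≠ 1}

theorem primes_finite : (primes w).Finite := by
  refine ((HeightOneSpectrum.Support.finite (𝓞 K) (w : K)).union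
    (HeightOneSpectrum.Support.finite (𝓞 K) ((w⁻¹ : Kˣ) : K))).subset ?_
  intro p hp
  have h0 : p.valuation K (w : K) ≠ 0 := by simp
  rcases lt_or_gt_of_ne (show p.valuation K (w : K) ≠ 1 from hp) with h | h
  · right
    change 1 < p.valuation K ((w⁻¹ : Kˣ) : K)
    rw [Units.val_inv_eq_inv_val, map_inv₀]
    exact (one_lt_inv₀ (zero_lt_iff.2 h0)).2 h
  · left
    exact h

instance : Fintype (primes w) := (primes_finite w).fintype

/-- The ring `𝒪_w = {x ∈ K | v_𝔭(x) ≥ 0 for all 𝔭 ∉ M_w}`. -/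
abbrev Ow : Subalgebra (𝓞 K) K := (primes w).integer K

/-- The units of a ring act on its additive group by multiplication. -/
def unitsMul (R : Type*) [CommRing R] : Rˣ →* MulAut (Multiplicative R) :=
  (MulAutMultiplicative R).symm.toMonoidHom.comp (DistribMulAction.toAddAut Rˣ R)

/-- The semi-direct product `𝒪_w ⋊ 𝒪_wˣ`, with `𝒪_wˣ` acting on `𝒪_w` by multiplication. -/
abbrev Gw : Type _ :=
  Multiplicative (Ow w) ⋊[unitsMul (Ow w)] (Ow w)ˣ

variable {w}

/-- The element `x` of `K` for `g = (x, y)`. -/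
def Gw.x (g : Gw w) : K := ((Multiplicative.toAdd g.left : Ow w) : K)

/-- The element `y` of `Kˣ` for `g = (x, y)`. -/
def Gw.y (g : Gw w) : Kˣ := Units.map (Ow w).val.toRingHom.toMonoidHom g.right

theorem Gw.x_one : (1 : Gw w).x = 0 := rfl

theorem Gw.y_one : (1 : Gw w).y = 1 := by simp [Gw.y]

theorem Gw.x_mul (g h : Gw w) : (g * h).x = g.x + g.y * h.x := rfl

theorem Gw.y_mul (g h : Gw w) : (g * h).y = g.y * h.y := by simp [Gw.y]

/-- The automorphism of `K ⊕ K` with the matrix `!![y, x; 0, 1]`. -/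
def matrixMap (x : K) (y : Kˣ) : (K × K) ≃ₗ[K] (K × K) where
  toFun z := (y * z.1 + x * z.2, z.2)
  map_add' a b := by ext <;> simp; ring
  map_smul' a b := by ext <;> simp; ring
  invFun z := ((y⁻¹ : Kˣ) * (z.1 - x * z.2), z.2)
  left_inv z := by ext <;> simp
  right_inv z := by ext <;> simp

/-- The homomorphism from `𝒪_w ⋊ 𝒪_wˣ` to `GL(K ⊕ K)`. -/
def toGL : Gw w →* ((K × K) ≃ₗ[K] (K × K)) where
  toFun g := matrixMap g.x g.y
  map_one' := by
    apply LinearEquiv.ext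
    rintro ⟨a, b⟩
    simp [matrixMap, Gw.x_one, Gw.y_one]
  map_mul' g h := by
    apply LinearEquiv.ext
    rintro ⟨a, b⟩
    simp only [matrixMap, Gw.x_mul, Gw.y_mul, LinearEquiv.mul_apply, LinearEquiv.coe_mk,
      LinearMap.coe_mk, AddHom.coe_mk, Units.val_mul]
    ext <;> simp; ring

/-- The action of `𝒪_w ⋊ 𝒪_wˣ` on the tree `T(v_𝔭)`. -/
instance (p : HeightOneSpectrum (𝓞 K)) : MulAction (Gw w) (Tree p) :=
  MulAction.compHom (Tree p) ((treeAut p).comp toGL)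

/-- The action of `𝒪_w ⋊ 𝒪_wˣ` on the components of the Minkowski space. -/
instance (v : InfinitePlace K) : MulAction (Gw w) (Mink v) where
  smul g z := Mink.affine g.x g.y z
  one_smul z := by
    apply Subtype.ext
    ext τ
    change τ.1 (1 : Gw w).y * z.1 τ + τ.1 (1 : Gw w).x = z.1 τ
    simp [Gw.x_one, Gw.y_one]
  mul_smul g h z := by
    apply Subtype.ext
    ext τ
    change τ.1 (g * h).y * z.1 τ + τ.1 (g * h).x =
      τ.1 g.y * (τ.1 h.y * z.1 τ + τ.1 h.x) + τ.1 g.x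
    simp only [Gw.x_mul, Gw.y_mul, Units.val_mul, map_add, map_mul]
    ring

end Group

/-! ### The space `Y_w` -/

section Space

variable {K : Type*} [Field K] [NumberField K] (w : Kˣ)

/-- The choices that enter in the construction of `Y_w` and of the action on it. -/
structure Choices where
  /-- A `ℤ`-basis of a free abelian subgroup of `𝒪ˣ`. -/
  e : Fin (Units.rank K) → (𝓞 K)ˣ
  /-- The group `𝒪ˣ` is the direct product of its finite cyclic torsion subgroup and of the free
  abelian group with the basis `e`. -/
  e_basis : Function.Bijective fun q : Units.torsion K × (Fin (Units.rank K) → ℤ) =>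
    (q.1 : (𝓞 K)ˣ) * ∏ i, e i ^ q.2 i
  /-- A projection of `𝒪_wˣ` onto the free abelian group with the basis `e`. -/
  α : (Ow w)ˣ →* Multiplicative (Fin (Units.rank K) → ℤ)
  α_e : ∀ i, α (Units.map (algebraMap (𝓞 K) (Ow w)).toMonoidHom (e i)) =
    Multiplicative.ofAdd (Pi.single i 1)
  /-- For every `𝔭 ∈ M_w` an element `y_𝔭` of `𝒪` that generates a power `𝔭 ^ m`, `m > 0`. -/
  yp : primes w → 𝓞 K
  yp_spec : ∀ p : primes w, ∃ m : ℕ, 0 < m ∧ Ideal.span {yp p} = p.1.asIdeal ^ m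

/-- The space `X_w = ℝ^{n_w} × ∏_{𝔭 ∈ M_w} T(v_𝔭)`, with the `ℓ²` product metric. -/
abbrev Xw : Type _ :=
  WithLp 2 (EuclideanSpace ℝ (Fin (Units.rank K)) × PiLp 2 fun p : primes w => Tree p.1)

variable {w} (c : Choices w)

/-- The warping function
`f^{[τ]}(r, (q_𝔭)) = ∏ᵢ |τ(eᵢ)|^{-rᵢ} ∏_𝔭 |τ(y_𝔭)|^{f_𝔭(q_𝔭) / v_𝔭(y_𝔭)}`. -/
def warping (v : InfinitePlace K) (a : Xw w) : ℝ :=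
  (∏ i, v (c.e i : K) ^ (-(a.fst i))) *
    ∏ p : primes w, v (c.yp p : K) ^ (busemann p.1 (a.snd p) / (ord p.1 (c.yp p : K) : ℝ))

/-- The points of `∏_{[τ]} X_w ×_{f^{[τ]}} (Minkowski component of [τ])` whose coordinates in `X_w`
coincide for all `[τ]`. -/
@[ext] structure Yw (c : Choices w) where
  pt : (v : InfinitePlace K) → Xw w × Mink v
  compat : ∀ v v' : InfinitePlace K, (pt v).1 = (pt v').1

/-- The metric of `Y_w`: the `ℓ²` product of the metrics of the warped products. -/
def Yw.edist {c : Choices w} (a b : Yw c) : ℝ≥0∞ :=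
  (∑ v : InfinitePlace K, warpedEDist (warping c v) (a.pt v) (b.pt v) ^ 2) ^ (1 / 2 : ℝ)

/-- The topology of the metric space `Y_w`. -/
instance : TopologicalSpace (Yw c) where
  IsOpen U := ∀ a ∈ U, ∃ ε : ℝ≥0∞, 0 < ε ∧ ∀ b, Yw.edist a b < ε → b ∈ U
  isOpen_univ := fun _ _ => ⟨1, one_pos, fun _ _ => trivial⟩
  isOpen_inter := by
    rintro U V hU hV a ⟨haU, haV⟩
    obtain ⟨ε, hε, h⟩ := hU a haU
    obtain ⟨δ, hδ, h'⟩ := hV a haV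
    exact ⟨min ε δ, lt_min hε hδ, fun b hb =>
      ⟨h b (hb.trans_le (min_le_left _ _)), h' b (hb.trans_le (min_le_right _ _))⟩⟩
  isOpen_sUnion := by
    rintro S hS a ⟨U, hU, ha⟩
    obtain ⟨ε, hε, h⟩ := hS U hU a ha
    exact ⟨ε, hε, fun b hb => ⟨U, hU, h b hb⟩⟩

/-- The diagonal action of `𝒪_w ⋊ 𝒪_wˣ` on `X_w`, where `(x, y)` acts on `ℝ^{n_w}` as the
translation by `α_w(y)`. -/
def actX (g : Gw w) (a : Xw w) : Xw w :=
  WithLp.toLp 2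
    (WithLp.toLp 2 fun i => ((Multiplicative.toAdd (c.α g.right) i : ℤ) : ℝ) + a.fst i,
      WithLp.toLp 2 fun p => g • a.snd p)

/-- The action of `𝒪_w ⋊ 𝒪_wˣ` on `Y_w`. -/
instance : MulAction (Gw w) (Yw c) where
  smul g a := ⟨fun v => (actX c g (a.pt v).1, g • (a.pt v).2),
    fun v v' => congrArg (actX c g) (a.compat v v')⟩
  one_smul a := by
    apply Yw.ext
    funext v
    refine Prod.ext ?_ (one_smul (Gw w) (a.pt v).2)
    change actX c 1 (a.pt v).1 = (a.pt v).1
    simp only [actX, SemidirectProduct.one_right, map_one, one_smul]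
    simp
    rfl
  mul_smul g h a := by
    apply Yw.ext
    funext v
    refine Prod.ext ?_ (mul_smul g h (a.pt v).2)
    change actX c (g * h) (a.pt v).1 = actX c g (actX c h (a.pt v).1)
    simp [actX, mul_smul, add_assoc]

end Space

end WarpedAction

end

/-!
The topology of `Y_w` is the product topology of `ℝ^{n_w} × ∏_𝔭 T(v_𝔭) × ∏_{[τ]} K_{ℝ,[τ]}`, so
both assertions can be checked in these coordinates. The warping functions are continuous, since
every Busemann function is `1`-Lipschitz, and they are positive. Near a point they are therefore
bounded, and the Lipschitz paths in the factors show that the topology of `Y_w` is not finer than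
the product topology (`continuous_ofCoord`). They are also bounded below by a positive number on a
ball, so that a single partition of a short path bounds the distances in the factors, and the
projections of `Y_w` are continuous (`continuous_Yw_fst`, `continuous_Yw_snd`).

The trees are described by normal forms: every lattice class is the class of a lattice with a basis
`(π ^ a, 0)`, `(b, 1)`, where `a` is unique and `b` is unique modulo `π ^ a`
(`exists_eq_normalClass`, `normalClass_eq_iff`), every edge joins two such classes with the same `b`
and consecutive values of `a` (`exists_normalClass_of_adj`), and the matrix `!![y, x; 0, 1]` sends
`(a, b)` to `(a + v(y), y * b + x)`.

For the cocompactness, `𝒪_w` is dense in `∏_𝔭 K_𝔭` (`exists_Ow_valuation_sub_le`), hence a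
translation moves the components of a point in the trees to the lines `b = 0`. The units `y_𝔭` and
`e_i` then move `a` into a bounded range of negative integers and the component in `ℝ^{n_w}` into
the unit cube (`exists_unit_reduction`). The remaining translations by `𝒪` fix these parts of the
lines, and `𝒪` is a lattice in the Minkowski space (`exists_integer_affine_norm_le`).

For the properness, an element `(x, y)` that moves a point of a compact set to a point of a compact
set moves the base points of the trees by a bounded distance. The height `a` and the depth
`-min(a, v(b))` of a class are `1`-Lipschitz functions, so the valuations of `y` are bounded and
those of `x` are bounded below. As `α_w(y)` is bounded too, only finitely many `y` occur
(`finite_setOf_unit`), then the conjugates of `x` are bounded, and only finitely many `x` occur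
(`finite_setOf_Ow`). It is not needed for this that the action is isometric.
-/

open NumberField IsDedekindDomain
open scoped ENNReal Pointwise unitInterval IntermediateField

noncomputable section

namespace WarpedAction

/-! ### Lipschitz functions and paths on the geometric realization of a graph -/

namespace Realization

variable {V : Type*} {G : SimpleGraph V}

/-- The extension of a function on the vertices to the geometric realization that is affine on
every edge. -/
def affineExt (h : V → ℝ) (p : Realization G) : ℝ := p.coord.sum fun v t => t * h v

theorem affineExt_eq (h : V → ℝ) {p : Realization G} {u v : V} {s : ℝ}
    (hp : p.coord = Finsupp.single u (1 - s) + Finsupp.single v s) :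
    affineExt h p = (1 - s) * h u + s * h v := by
  classical
  rw [affineExt, hp, Finsupp.sum_add_index' (by simp) (by intros; ring),
    Finsupp.sum_single_index (by simp), Finsupp.sum_single_index (by simp)]

theorem affineExt_vertex (h : V → ℝ) (v : V) : affineExt h (vertex G v) = h v := by
  rw [affineExt_eq h (u := v) (v := v) (s := 0) (by simp [vertex])]; ring

theorem Chain.abs_affineExt_sub_le {h : V → ℝ} (hh : ∀ u v, G.Adj u v → |h u - h v| ≤ 1)
    {p q : Realization G} {r : ℝ} (hc : Chain p q r) : |affineExt h p - affineExt h q| ≤ r := by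
  induction hc with
  | refl => simp
  | @step q q' r s _ h2 ih =>
    obtain ⟨u, v, s, t, hs, ht, ha, hp, hq, rfl⟩ := h2
    refine (abs_sub_le _ (affineExt h q) _).trans (add_le_add ih ?_)
    rw [affineExt_eq h hp, affineExt_eq h hq]
    have : (1 - s) * h u + s * h v - ((1 - t) * h u + t * h v) = -(s - t) * (h u - h v) := by ring
    rw [this, abs_mul, abs_neg]
    exact mul_le_of_le_one_right (abs_nonneg _) (hh u v ha)

/-- The affine extension of a function that changes by at most `1` along the edges is
`1`-Lipschitz. -/
theorem ofReal_abs_affineExt_sub_le {h : V → ℝ} (hh : ∀ u v, G.Adj u v → |h u - h v| ≤ 1)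
    (p q : Realization G) : ENNReal.ofReal |affineExt h p - affineExt h q| ≤ edist p q :=
  le_iInf₂ fun _ hc => ENNReal.ofReal_le_ofReal (hc.abs_affineExt_sub_le hh)

theorem Chain.edist_le {p q : Realization G} {r : ℝ} (h : Chain p q r) :
    edist p q ≤ ENNReal.ofReal r :=
  iInf₂_le r h

theorem OnEdge.edist_le {p q : Realization G} {r : ℝ} (h : OnEdge p q r) :
    edist p q ≤ ENNReal.ofReal r := by
  simpa using ((Chain.refl p).step h).edist_le

theorem edist_vertex_le_one {u v : V} (h : G.Adj u v) :
    edist (vertex G u) (vertex G v) ≤ 1 := by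
  have : OnEdge (vertex G u) (vertex G v) 1 :=
    ⟨u, v, 0, 1, by simp, by simp, h, by simp [vertex], by simp [vertex], by simp⟩
  simpa using this.edist_le

theorem smul_coord (φ : G ≃g G) (p : Realization G) : (φ • p).coord = p.coord.mapDomain φ := rfl

theorem OnEdge.smul (φ : G ≃g G) {p q : Realization G} {r : ℝ} (h : OnEdge p q r) :
    OnEdge (φ • p) (φ • q) r := by
  obtain ⟨u, v, s, t, hs, ht, ha, hp, hq, rfl⟩ := h
  refine ⟨φ u, φ v, s, t, hs, ht, φ.map_adj_iff.2 ha, ?_, ?_, rfl⟩ <;>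
  simp only [smul_coord, hp, hq, Finsupp.mapDomain_add, Finsupp.mapDomain_single]

theorem Chain.smul (φ : G ≃g G) {p q : Realization G} {r : ℝ} (h : Chain p q r) :
    Chain (φ • p) (φ • q) r := by
  induction h with
  | refl => exact Chain.refl _
  | step _ h2 ih => exact ih.step (h2.smul φ)

theorem edist_smul_le (φ : G ≃g G) (p q : Realization G) : edist (φ • p) (φ • q) ≤ edist p q :=
  le_iInf₂ fun _ h => (h.smul φ).edist_le

/-- The point `(1 - t) u + t v` of the edge from `u` to `v`. -/
def edgePoint {u v : V} (h : G.Adj u v) (t : I) : Realization G :=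
  ⟨Finsupp.single u (1 - (t : ℝ)) + Finsupp.single v (t : ℝ), u, v, t, t.2, Or.inr h, rfl⟩

theorem edist_edgePoint_le {u v : V} (h : G.Adj u v) (s t : I) :
    edist (edgePoint h s) (edgePoint h t) ≤ edist s t := by
  have : OnEdge (edgePoint h s) (edgePoint h t) |(s : ℝ) - t| :=
    ⟨u, v, s, t, s.2, t.2, h, rfl, rfl, rfl⟩
  refine this.edist_le.trans_eq ?_
  rw [Subtype.edist_eq, edist_dist, Real.dist_eq]

theorem continuous_edgePoint {u v : V} (h : G.Adj u v) : Continuous (edgePoint h) :=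
  LipschitzWith.continuous (K := 1) fun s t => by simpa using edist_edgePoint_le h s t

theorem eq_edgePoint {p : Realization G} {u v : V} {t : ℝ} (ht : t ∈ Set.Icc (0 : ℝ) 1)
    (h : G.Adj u v) (hp : p.coord = Finsupp.single u (1 - t) + Finsupp.single v t) :
    p = edgePoint h ⟨t, ht⟩ :=
  Realization.ext hp

/-- Two points of an edge are joined by a path in this edge that is `1`-Lipschitz. -/
theorem OnEdge.exists_lipschitz {p q : Realization G} {r : ℝ} (h : OnEdge p q r) :
    ∃ γ : ℝ → Realization G, γ 0 = p ∧ γ r = q ∧ LipschitzWith 1 γ := by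
  obtain ⟨u, v, s, t, hs, ht, ha, hp, hq, rfl⟩ := h
  obtain ⟨ε, hε, hst⟩ : ∃ ε : ℝ, ‖ε‖₊ = 1 ∧ s + ε * |s - t| = t := by
    rcases le_total s t with h | h
    · exact ⟨1, by simp, by rw [abs_of_nonpos (by linarith)]; ring⟩
    · exact ⟨-1, by simp, by rw [abs_of_nonneg (by linarith)]; ring⟩
  refine ⟨fun τ => edgePoint ha (Set.projIcc 0 1 zero_le_one (s + ε * τ)), ?_, ?_, ?_⟩
  · simp only [mul_zero, add_zero]
    rw [Set.projIcc_of_mem _ hs]; exact (eq_edgePoint hs ha hp).symm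
  · simp only [hst]
    rw [Set.projIcc_of_mem _ ht]; exact (eq_edgePoint ht ha hq).symm
  · have h1 : LipschitzWith 1 (edgePoint ha) := fun a b => by
      simpa using edist_edgePoint_le ha a b
    have h2 : LipschitzWith 1 (fun τ : ℝ => s + ε * τ) := fun a b => by
      rw [edist_add_left, ENNReal.coe_one, one_mul, edist_dist, edist_dist, Real.dist_eq,
        Real.dist_eq, ← mul_sub, abs_mul]
      have : |ε| = 1 := by simpa using congrArg NNReal.toReal hε
      rw [this, one_mul]
    simpa [Function.comp_def] using h1.comp ((LipschitzWith.projIcc zero_le_one).comp h2)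

/-- A piecewise linear path of length `r` has a `1`-Lipschitz parametrization by `[0, r]`, extended
to the real line. -/
theorem Chain.exists_lipschitz {p q : Realization G} {r : ℝ} (h : Chain p q r) :
    ∃ γ : ℝ → Realization G, γ 0 = p ∧ γ r = q ∧ LipschitzWith 1 γ := by
  induction h with
  | refl => exact ⟨fun _ => p, rfl, rfl, LipschitzWith.const' p⟩
  | @step q q' r s hc h2 ih =>
    obtain ⟨γ, h0, h1, hl⟩ := ih
    obtain ⟨δ, k0, k1, kl⟩ := h2.exists_lipschitz
    have hr := hc.nonneg
    have hs := h2.nonneg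
    have key : ∀ a b : ℝ, a ≤ r → r ≤ b → edist (γ a) (δ (b - r)) ≤ edist a b := by
      intro a b ha hb
      calc edist (γ a) (δ (b - r)) ≤ edist (γ a) (γ r) + edist (δ 0) (δ (b - r)) := by
            rw [k0, h1]; exact edist_triangle _ _ _
        _ ≤ edist a r + edist 0 (b - r) := by
            gcongr
            · simpa using hl a r
            · simpa using kl 0 (b - r)
        _ = edist a b := by
            simp only [edist_dist, Real.dist_eq]
            rw [← ENNReal.ofReal_add (abs_nonneg _) (abs_nonneg _),
              abs_of_nonpos (by linarith : a - r ≤ 0),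
              abs_of_nonpos (by linarith : 0 - (b - r) ≤ 0),
              abs_of_nonpos (by linarith : a - b ≤ 0)]
            congr 1; ring
    refine ⟨fun t => if t ≤ r then γ t else δ (t - r), by simp [hr, h0], ?_, fun a b => ?_⟩
    · by_cases hs0 : s = 0
      · subst hs0; simp [h1, ← k0, k1]
      · have : ¬ r + s ≤ r := by
          have := lt_of_le_of_ne hs (Ne.symm hs0); linarith
        simp only [this, if_false]
        rw [add_sub_cancel_left, k1]
    · simp only [ENNReal.coe_one, one_mul]
      by_cases ha : a ≤ r <;> by_cases hb : b ≤ r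
      · simpa [ha, hb] using hl a b
      · simpa [ha, hb] using key a b ha (not_le.1 hb).le
      · simpa [ha, hb, edist_comm] using key b a hb (not_le.1 ha).le
      · simp only [ha, hb, if_false]
        refine (kl _ _).trans ?_
        simp [edist_sub_right]

/-- Points at distance less than `C` are joined by a `C`-Lipschitz path on the unit interval. -/
theorem exists_lipschitz_path {p q : Realization G} {C : NNReal} (h : edist p q < C) :
    ∃ γ : I → Realization G, γ 0 = p ∧ γ 1 = q ∧ LipschitzWith C γ := by
  obtain ⟨r, hr⟩ := iInf_lt_iff.1 h
  obtain ⟨hc, hr⟩ := iInf_lt_iff.1 hr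
  obtain ⟨γ, h0, h1, hl⟩ := hc.exists_lipschitz
  refine ⟨fun t => γ (r * t), by simp [h0], by simp [h1], fun a b => ?_⟩
  refine (hl _ _).trans ?_
  rw [ENNReal.coe_one, one_mul, Subtype.edist_eq, edist_dist, edist_dist, Real.dist_eq,
    Real.dist_eq, ← mul_sub, abs_mul, abs_of_nonneg hc.nonneg, ENNReal.ofReal_mul hc.nonneg]
  gcongr

end Realization

/-! ### Lattices in normal form -/

section NormalForm

open WithZero Realization

variable {K : Type*} [Field K] [NumberField K] (p : HeightOneSpectrum (𝓞 K))

theorem valuation_unif : p.valuation K (unif p : K) = exp (-1 : ℤ) :=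
  (p.valuation_exists_uniformizer K).choose_spec

theorem unif_ne_zero : (unif p : K) ≠ 0 := p.valuation_uniformizer_ne_zero K

theorem valuation_unif_zpow (a : ℤ) : p.valuation K ((unif p : K) ^ a) = exp (-a) := by
  rw [map_zpow₀, valuation_unif, ← exp_zsmul]; simp

theorem mem_localRing {x : K} : x ∈ LocalRing p ↔ p.valuation K x ≤ 1 := Iff.rfl

/-- The valuation of a nonzero element, in terms of `ord`. -/
theorem valuation_eq_exp_ord {x : K} (hx : x ≠ 0) : p.valuation K x = exp (-ord p x) := by
  rw [ord, neg_neg, exp_log ((Valuation.ne_zero_iff _).2 hx)]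

theorem linearIndependent_normalForm (a : ℤ) (b : K) :
    LinearIndependent (LocalRing p) ![((unif p : K) ^ a, (0 : K)), (b, 1)] := by
  rw [LinearIndependent.pair_iff]
  rintro ⟨s, hs⟩ ⟨t, ht⟩ h
  have h1 : s * unif p ^ a + t * b = 0 := congrArg Prod.fst h
  have h2 : s * 0 + t * 1 = 0 := congrArg Prod.snd h
  have h3 : t = 0 := by simpa using h2
  subst h3
  have h4 : s = 0 := by simpa [zpow_ne_zero a (unif_ne_zero p)] using h1
  subst h4
  exact ⟨rfl, rfl⟩

/-- The lattice with the basis `(π ^ a, 0)`, `(b, 1)`. -/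
def normalForm (a : ℤ) (b : K) : Lattice p :=
  ⟨Submodule.span (LocalRing p) (Set.range ![((unif p : K) ^ a, (0 : K)), (b, 1)]),
    Submodule.fg_span (Set.toFinite _), by
    rw [Submodule.span_span_of_tower, eq_top_iff]
    rintro ⟨x, y⟩ -
    rw [Matrix.range_cons, Matrix.range_cons, Matrix.range_empty, Set.union_empty,
      Set.singleton_union, Submodule.mem_span_pair]
    refine ⟨(x - y * b) * (unif p) ^ (-a), y, ?_⟩
    ext <;> simp [mul_assoc, inv_mul_cancel₀ (zpow_ne_zero a (unif_ne_zero p))]⟩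

variable {p}

theorem mem_normalForm {a : ℤ} {b : K} {z : K × K} :
    z ∈ (normalForm p a b).1 ↔
      p.valuation K z.2 ≤ 1 ∧ p.valuation K (z.1 - b * z.2) ≤ exp (-a) := by
  have hπ := zpow_ne_zero a (unif_ne_zero p)
  change z ∈ Submodule.span _ _ ↔ _
  rw [Matrix.range_cons, Matrix.range_cons, Matrix.range_empty, Set.union_empty,
      Set.singleton_union, Submodule.mem_span_pair]
  constructor
  · rintro ⟨⟨s, hs⟩, ⟨t, ht⟩, rfl⟩
    rw [mem_localRing] at hs ht
    have e1 : ((⟨s, hs⟩ : LocalRing p) • ((unif p : K) ^ a, (0 : K)) +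
      (⟨t, ht⟩ : LocalRing p) • (b, (1 : K))) = (s * unif p ^ a + t * b, s * 0 + t * 1) := rfl
    rw [e1]
    refine ⟨by simpa using ht, ?_⟩
    simp only [mul_zero, mul_one, zero_add]
    rw [mul_comm b, add_sub_cancel_right, map_mul, valuation_unif_zpow]
    exact mul_le_of_le_one_left zero_le hs
  · rintro ⟨h1, h2⟩
    refine ⟨⟨(z.1 - b * z.2) / unif p ^ a, ?_⟩, ⟨z.2, h1⟩, ?_⟩
    · rw [mem_localRing, map_div₀, valuation_unif_zpow]
      exact div_le_one_of_le₀ h2 zero_le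
    · change ((z.1 - b * z.2) / unif p ^ a * unif p ^ a + z.2 * b,
        (z.1 - b * z.2) / unif p ^ a * 0 + z.2 * 1) = z
      ext
      · simp only []
        rw [div_mul_cancel₀ _ hπ]; ring
      · simp

theorem Lattice.ext' {L L' : Lattice p} (h : ∀ z, z ∈ L.1 ↔ z ∈ L'.1) : L = L' :=
  Subtype.ext (Submodule.ext h)

theorem mem_smul_lattice (φ : (K × K) ≃ₗ[K] (K × K)) (L : Lattice p) (z : K × K) :
    z ∈ (φ • L).1 ↔ φ.symm z ∈ L.1 := by
  constructor
  · rintro ⟨y, hy, rfl⟩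
    change φ.symm (φ y) ∈ L.1
    rwa [LinearEquiv.symm_apply_apply]
  · intro h
    exact ⟨_, h, φ.apply_symm_apply z⟩

theorem mem_scalar_smul (x : Kˣ) (L : Lattice p) (z : K × K) :
    z ∈ (scalar x • L).1 ↔ ((x⁻¹ : Kˣ) : K) • z ∈ L.1 :=
  mem_smul_lattice _ _ _

theorem normalForm_eq_of_le {a : ℤ} {b b' : K} (h : p.valuation K (b - b') ≤ exp (-a)) :
    normalForm p a b = normalForm p a b' := by
  have key : ∀ {b b' : K}, p.valuation K (b - b') ≤ exp (-a) →
      ∀ z, z ∈ (normalForm p a b).1 → z ∈ (normalForm p a b').1 := by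
    intro b b' h z hz
    rw [mem_normalForm] at hz ⊢
    refine ⟨hz.1, ?_⟩
    have : z.1 - b' * z.2 = (z.1 - b * z.2) + (b - b') * z.2 := by ring
    rw [this]
    refine Valuation.map_add_le _ hz.2 ?_
    rw [map_mul]
    exact (mul_le_of_le_one_right zero_le hz.1).trans h
  refine Lattice.ext' fun z => ⟨key h z, key ?_ z⟩
  rwa [Valuation.map_sub_swap]

theorem matrixMap_smul_normalForm (x : K) (y : Kˣ) (a : ℤ) (b : K) :
    matrixMap x y • normalForm p a b = normalForm p (a + ord p (y : K)) (y * b + x) := by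
  refine Lattice.ext' fun z => ?_
  rw [mem_smul_lattice, mem_normalForm, mem_normalForm]
  refine and_congr Iff.rfl ?_
  change p.valuation K (((y⁻¹ : Kˣ) : K) * (z.1 - x * z.2) - b * z.2) ≤ _ ↔ _
  have hy : (y : K) ≠ 0 := y.ne_zero
  have h1 : z.1 - (y * b + x) * z.2 =
      y * (((y⁻¹ : Kˣ) : K) * (z.1 - x * z.2) - b * z.2) := by
    rw [Units.val_inv_eq_inv_val]; field_simp; ring
  rw [h1, map_mul, valuation_eq_exp_ord p hy, neg_add_rev, exp_add]
  rw [mul_le_mul_iff_right₀ exp_pos]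

variable (p) in
/-- The class of the lattice with the basis `(π ^ a, 0)`, `(b, 1)`. -/
def normalClass (a : ℤ) (b : K) : LatticeClass p := ⟦normalForm p a b⟧

theorem normalClass_eq_iff {a a' : ℤ} {b b' : K} :
    normalClass p a b = normalClass p a' b' ↔ a = a' ∧ p.valuation K (b - b') ≤ exp (-a) := by
  constructor
  · intro h
    obtain ⟨x, hx⟩ : ∃ x : Kˣ, normalForm p a b = scalar x • normalForm p a' b' :=
      Quotient.exact h
    have key : ∀ z : K × K, z ∈ (normalForm p a b).1 ↔
        ((x⁻¹ : Kˣ) : K) • z ∈ (normalForm p a' b').1 := fun z => by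
      rw [hx, mem_scalar_smul]
    have hx0 : (x : K) ≠ 0 := x.ne_zero
    have hm : ∀ (a : ℤ) (b : K), ((b, 1) : K × K) ∈ (normalForm p a b).1 := fun a b => by
      simp [mem_normalForm]
    have hm' : ∀ (a : ℤ) (b : K), ((unif p ^ a, 0) : K × K) ∈ (normalForm p a b).1 :=
      fun a b => by simp [mem_normalForm, -map_zpow₀, valuation_unif_zpow]
    have e1 := (mem_normalForm.1 ((key _).1 (hm a b)))
    have e2 := (mem_normalForm.1 ((key _).1 (hm' a b))).2
    have e3 := mem_normalForm.1 ((key ((x : K) • (b', 1))).2 (by simpa [smul_smul] using hm a' b'))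
    have e4 := mem_normalForm.1 ((key ((x : K) • (unif p ^ a', 0))).2
      (by simpa [smul_smul, -Prod.smul_mk] using hm' a' b'))
    have hv : p.valuation K (x : K) = 1 := by
      refine le_antisymm (by simpa using e3.1) ?_
      have := e1.1
      simp only [Prod.smul_snd, smul_eq_mul, mul_one, Units.val_inv_eq_inv_val, map_inv₀] at this
      exact (inv_le_one₀ (zero_lt_iff.2 (by simp))).1 this
    simp only [Prod.smul_mk, smul_eq_mul, mul_zero, sub_zero, map_mul, valuation_unif_zpow,
      Units.val_inv_eq_inv_val, map_inv₀, hv, inv_one, one_mul, exp_le_exp] at e2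
    have e4 := e4.2
    simp only [Prod.smul_mk, smul_eq_mul, mul_zero, sub_zero, map_mul, valuation_unif_zpow,
      hv, one_mul, exp_le_exp] at e4
    refine ⟨by omega, ?_⟩
    obtain rfl : a = a' := by omega
    have e1 := e1.2
    simp only [Prod.smul_mk, smul_eq_mul, mul_one, Units.val_inv_eq_inv_val] at e1
    rwa [mul_comm b', ← mul_sub, map_mul, map_inv₀, hv, inv_one, one_mul] at e1
  · rintro ⟨rfl, h⟩
    exact congrArg (Quotient.mk _) (normalForm_eq_of_le h)

/-- A finitely generated module over the local ring in `K` is generated by one element. -/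
theorem exists_span_singleton_eq {N : Submodule (LocalRing p) K} (h : N.FG) :
    ∃ x : K, N = Submodule.span (LocalRing p) {x} := by
  have key : ∀ x y : K, p.valuation K x ≤ p.valuation K y →
      Submodule.span (LocalRing p) {x} ≤ Submodule.span (LocalRing p) {y} := by
    intro x y hxy
    rw [Submodule.span_singleton_le_iff_mem, Submodule.mem_span_singleton]
    by_cases hy : y = 0
    · subst hy
      exact ⟨0, by simpa using ((by simpa using hxy : x = 0)).symm⟩
    · exact ⟨⟨x / y, by rw [mem_localRing, map_div₀]; exact div_le_one_of_le₀ hxy zero_le⟩,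
        div_mul_cancel₀ x hy⟩
  induction N, h using Submodule.fg_induction with
  | singleton x => exact ⟨x, rfl⟩
  | sup M₁ M₂ _ _ h₁ h₂ =>
    obtain ⟨x, rfl⟩ := h₁
    obtain ⟨y, rfl⟩ := h₂
    rcases le_total (p.valuation K x) (p.valuation K y) with h | h
    · exact ⟨y, sup_eq_right.2 (key x y h)⟩
    · exact ⟨x, sup_eq_left.2 (key y x h)⟩

/-- Every lattice class contains a lattice in normal form: the projection of a lattice to the
second coordinate and its intersection with `K × 0` are generated by one element each. -/
theorem exists_eq_normalClass (C : LatticeClass p) : ∃ a b, C = normalClass p a b := by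
  induction C using Quotient.inductionOn with | _ L => ?_
  obtain ⟨L, hfg, hsp⟩ := L
  obtain ⟨t, ht⟩ := exists_span_singleton_eq (hfg.map (LinearMap.snd (LocalRing p) K K))
  have htop : ∀ f : (K × K) →ₗ[K] K, (∀ z ∈ L, f z = 0) → f = 0 := by
    intro f hf
    ext1 <;> ext
    all_goals
    · have : Submodule.span K (L : Set (K × K)) ≤ LinearMap.ker f :=
        Submodule.span_le.2 fun z hz => hf z hz
      rw [hsp] at this
      exact this trivial
  have ht0 : t ≠ 0 := by
    rintro rfl
    have := htop (LinearMap.snd K K K) fun z hz => by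
      have : z.2 ∈ L.map (LinearMap.snd (LocalRing p) K K) := ⟨z, hz, rfl⟩
      rw [ht, Submodule.span_zero_singleton] at this
      exact this
    simpa using LinearMap.congr_fun this (0, 1)
  obtain ⟨⟨b, t'⟩, hbL, rfl⟩ : t ∈ L.map (LinearMap.snd (LocalRing p) K K) := by
    rw [ht]; exact Submodule.mem_span_singleton_self t
  change t' ≠ 0 at ht0
  have hsnd : ∀ z ∈ L, p.valuation K (z.2 / t') ≤ 1 := by
    intro z hz
    have : z.2 ∈ L.map (LinearMap.snd (LocalRing p) K K) := ⟨z, hz, rfl⟩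
    rw [ht, Submodule.mem_span_singleton] at this
    obtain ⟨⟨s, hs⟩, hst⟩ := this
    have : z.2 = s * t' := hst.symm
    rw [this, mul_div_cancel_right₀ _ ht0]
    exact hs
  -- The kernel of the projection is the image of `L` under `z ↦ z - (z.2 / t') (b, t')`.
  let ψ : (K × K) →ₗ[LocalRing p] K :=
    (LinearMap.fst K K K - (b / t') • LinearMap.snd K K K).restrictScalars (LocalRing p)
  have hψ : ∀ z, ψ z = z.1 - b / t' * z.2 := fun z => rfl
  obtain ⟨s, hs⟩ := exists_span_singleton_eq (hfg.map ψ)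
  have hs0 : s ≠ 0 := by
    rintro rfl
    have := htop (LinearMap.fst K K K - (b / t') • LinearMap.snd K K K) fun z hz => by
      have : ψ z ∈ L.map ψ := ⟨z, hz, rfl⟩
      rw [hs, Submodule.span_zero_singleton] at this
      exact this
    simpa using LinearMap.congr_fun this (1, 0)
  have hker : ∀ x : K, (x, 0) ∈ L ↔ p.valuation K x ≤ p.valuation K s := by
    intro x
    constructor
    · intro hx
      have : ψ (x, 0) ∈ L.map ψ := ⟨_, hx, rfl⟩
      rw [hψ, hs, Submodule.mem_span_singleton] at this
      obtain ⟨⟨r, hr⟩, hrs⟩ := this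
      have hrs' : x - b / t' * 0 = r * s := hrs.symm
      have : x = r * s := by simpa using hrs'
      rw [this, map_mul]
      exact mul_le_of_le_one_left zero_le hr
    · intro hx
      have : x ∈ L.map ψ := by
        rw [hs, Submodule.mem_span_singleton]
        exact ⟨⟨x / s, by rw [mem_localRing, map_div₀]; exact div_le_one_of_le₀ hx zero_le⟩,
          div_mul_cancel₀ x hs0⟩
      obtain ⟨z, hz, rfl⟩ := this
      have h2 : (⟨z.2 / t', hsnd z hz⟩ : LocalRing p) • (b, t') ∈ L := L.smul_mem _ hbL
      have h3 := L.sub_mem hz h2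
      convert h3 using 1
      change (z.1 - b / t' * z.2, (0 : K)) = (z.1 - z.2 / t' * b, z.2 - z.2 / t' * t')
      ext <;> simp only []
      · ring
      · rw [div_mul_cancel₀ _ ht0, sub_self]
  -- The lattice is `t'` times the lattice with the basis `(s / t', 0)`, `(b / t', 1)`.
  refine ⟨ord p (s / t'), b / t', Quotient.sound ⟨Units.mk0 t' ht0, Lattice.ext' fun z => ?_⟩⟩
  rw [mem_scalar_smul, mem_normalForm]
  rw [← valuation_eq_exp_ord p (div_ne_zero hs0 ht0)]
  simp only [Units.val_inv_eq_inv_val, Units.val_mk0, Prod.smul_fst, Prod.smul_snd, smul_eq_mul]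
  have h1 : t'⁻¹ * z.1 - b / t' * (t'⁻¹ * z.2) = (z.1 - b / t' * z.2) / t' := by ring
  have hv : 0 < p.valuation K t' := zero_lt_iff.2 ((Valuation.ne_zero_iff _).2 ht0)
  rw [h1, map_div₀, map_div₀, div_le_div_iff_of_pos_right hv, ← hker, inv_mul_eq_div]
  change z ∈ L ↔ _
  constructor
  · intro hz
    refine ⟨hsnd z hz, ?_⟩
    have h2 : (⟨z.2 / t', hsnd z hz⟩ : LocalRing p) • (b, t') ∈ L := L.smul_mem _ hbL
    convert L.sub_mem hz h2 using 1
    change (z.1 - b / t' * z.2, (0 : K)) = (z.1 - z.2 / t' * b, z.2 - z.2 / t' * t')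
    ext <;> simp only []
    · ring
    · rw [div_mul_cancel₀ _ ht0, sub_self]
  · rintro ⟨hz, hz'⟩
    have h2 : (⟨z.2 / t', hz⟩ : LocalRing p) • (b, t') ∈ L := L.smul_mem _ hbL
    convert L.add_mem hz' h2 using 1
    change z = (z.1 - b / t' * z.2 + z.2 / t' * b, (0 : K) + z.2 / t' * t')
    ext <;> simp only []
    · ring
    · rw [div_mul_cancel₀ _ ht0, zero_add]

end NormalForm

/-! ### Adjacency and distances in the tree -/

section Adjacency

open WithZero Realization

variable {K : Type*} [Field K] [NumberField K] {p : HeightOneSpectrum (𝓞 K)}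

/-- Adjacent lattice classes have representatives `L₁`, `x L₂` with `π L₁ ⊆ x L₂ ⊆ L₁`. -/
theorem IsDist.exists_sandwich {L₁ L₂ : Lattice p} (h : IsDist L₁ L₂ 1) :
    ∃ x : Kˣ, (∀ z ∈ L₂.1, (x : K) • z ∈ L₁.1) ∧
      ∀ z ∈ L₁.1, ((x⁻¹ : Kˣ) : K) • unif p • z ∈ L₂.1 := by
  obtain ⟨b₁, b₂, a, hb, ha⟩ := h
  have hπ := unif_ne_zero p (K := K)
  -- After scaling `L₂` by `π ^ (-m)`, the exponents are `0` and `1`.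
  set m := min (a 0) (a 1)
  have ham : ∀ i, 0 ≤ a i - m ∧ a i - m ≤ 1 := by
    intro i
    rcases abs_eq (by norm_num : (0 : ℤ) ≤ 1) |>.1 ha with h | h <;> fin_cases i <;>
      simp only [Fin.zero_eta, Fin.mk_one] <;> omega
  have hint : ∀ n : ℤ, 0 ≤ n → unif p ^ n ∈ LocalRing p (K := K) := by
    intro n hn
    rw [mem_localRing, valuation_unif_zpow, ← exp_zero, exp_le_exp]; omega
  have hsum : ∀ (L : Lattice p) (b : Module.Basis (Fin 2) (LocalRing p) L.1) (z) (hz : z ∈ L.1),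
      z = ∑ i, ((b.repr ⟨z, hz⟩ i : LocalRing p) : K) • (b i : K × K) := by
    intro L b z hz
    have := congrArg Subtype.val (b.sum_repr ⟨z, hz⟩)
    exact this.symm.trans (by rw [Submodule.coe_sum]; rfl)
  have hx : unif p ^ (-m) ≠ (0 : K) := zpow_ne_zero _ hπ
  refine ⟨Units.mk0 _ hx, fun z hz => ?_, fun z hz => ?_⟩
  · rw [hsum L₂ b₂ z hz, Finset.smul_sum]
    refine Submodule.sum_mem _ fun i _ => ?_
    have : ((Units.mk0 _ hx : Kˣ) : K) • ((b₂.repr ⟨z, hz⟩ i : LocalRing p) : K) • (b₂ i : K × K) =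
        (b₂.repr ⟨z, hz⟩ i * ⟨_, hint _ (ham i).1⟩ : LocalRing p) • (b₁ i : K × K) := by
      rw [hb i, smul_smul, smul_smul]
      change _ = (((b₂.repr ⟨z, hz⟩ i : LocalRing p) : K) * unif p ^ (a i - m)) • (b₁ i : K × K)
      congr 1
      rw [Units.val_mk0, sub_eq_add_neg, zpow_add₀ hπ]; ring
    rw [this]
    exact Submodule.smul_mem _ _ (b₁ i).2
  · rw [hsum L₁ b₁ z hz, Finset.smul_sum, Finset.smul_sum]
    refine Submodule.sum_mem _ fun i _ => ?_
    have : (((Units.mk0 _ hx)⁻¹ : Kˣ) : K) • unif p • ((b₁.repr ⟨z, hz⟩ i : LocalRing p) : K) •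
        (b₁ i : K × K) =
        (b₁.repr ⟨z, hz⟩ i * ⟨_, hint (1 - (a i - m)) (by linarith [(ham i).2])⟩ : LocalRing p) •
          (b₂ i : K × K) := by
      rw [hb i, smul_smul, smul_smul]
      change _ = (((b₁.repr ⟨z, hz⟩ i : LocalRing p) : K) * unif p ^ (1 - (a i - m))) •
        unif p ^ a i • (b₁ i : K × K)
      rw [smul_smul]
      congr 1
      rw [Units.val_inv_eq_inv_val, Units.val_mk0, zpow_neg, inv_inv, mul_assoc (_ : K) (_ : K)
        (unif p ^ a i), ← zpow_add₀ hπ, show 1 - (a i - m) + a i = m + 1 by ring,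
        zpow_add_one₀ hπ]
      ring
    rw [this]
    exact Submodule.smul_mem _ _ (b₂ i).2

/-- In normal form, the inclusions `π L₁ ⊆ x L₂ ⊆ L₁` leave only the cases `v(x) = 0` and
`v(x) = 1`, in which the exponent `a` increases or decreases by `1` from `L₁` to `L₂`. -/
theorem IsDist.exists_normalClass {L₁ L₂ : Lattice p} (h : IsDist L₁ L₂ 1)
    (hne : (⟦L₁⟧ : LatticeClass p) ≠ ⟦L₂⟧) :
    ∃ a b, ((⟦L₁⟧ : LatticeClass p) = normalClass p a b ∧
        (⟦L₂⟧ : LatticeClass p) = normalClass p (a + 1) b) ∨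
      ((⟦L₂⟧ : LatticeClass p) = normalClass p a b ∧
        (⟦L₁⟧ : LatticeClass p) = normalClass p (a + 1) b) := by
  obtain ⟨a, b, hab⟩ := exists_eq_normalClass (⟦L₁⟧ : LatticeClass p)
  obtain ⟨a', b', hab'⟩ := exists_eq_normalClass (⟦L₂⟧ : LatticeClass p)
  obtain ⟨x₁, hx₁⟩ : ∃ x : Kˣ, L₁ = scalar x • normalForm p a b := Quotient.exact hab
  obtain ⟨x₂, hx₂⟩ : ∃ x : Kˣ, L₂ = scalar x • normalForm p a' b' := Quotient.exact hab'
  obtain ⟨y, hy₁, hy₂⟩ := h.exists_sandwich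
  obtain ⟨x, h1, h2⟩ : ∃ x : Kˣ,
      (∀ z ∈ (normalForm p a' b').1, (x : K) • z ∈ (normalForm p a b).1) ∧
      ∀ z ∈ (normalForm p a b).1, ((x⁻¹ : Kˣ) : K) • unif p • z ∈ (normalForm p a' b').1 := by
    refine ⟨x₁⁻¹ * y * x₂, fun z hz => ?_, fun z hz => ?_⟩
    · have := hy₁ ((x₂ : K) • z) (by rw [hx₂, mem_scalar_smul, smul_smul]; simpa using hz)
      rw [hx₁, mem_scalar_smul] at this
      simpa only [smul_smul, Units.val_mul, mul_assoc] using this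
    · have := hy₂ ((x₁ : K) • z) (by rw [hx₁, mem_scalar_smul, smul_smul]; simpa using hz)
      rw [hx₂, mem_scalar_smul] at this
      simp only [smul_smul] at this ⊢
      convert this using 2
      simp only [mul_inv_rev, inv_inv, Units.val_mul]
      ring
  have hxv := valuation_eq_exp_ord p x.ne_zero
  generalize ord p (x : K) = n at hxv
  have hxv' : p.valuation K (((x⁻¹ : Kˣ) : K)) = exp n := by
    rw [Units.val_inv_eq_inv_val, map_inv₀, hxv, ← exp_neg, neg_neg]
  have hm : ∀ (a : ℤ) (b : K), ((b, 1) : K × K) ∈ (normalForm p a b).1 := fun a b => by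
    simp [mem_normalForm]
  have hm' : ∀ (a : ℤ) (b : K), ((unif p ^ a, 0) : K × K) ∈ (normalForm p a b).1 :=
    fun a b => by simp [mem_normalForm, -map_zpow₀, valuation_unif_zpow]
  have e1 := mem_normalForm.1 (h1 _ (hm a' b'))
  have e2 := (mem_normalForm.1 (h1 _ (hm' a' b'))).2
  have e3 := mem_normalForm.1 (h2 _ (hm a b))
  have e4 := (mem_normalForm.1 (h2 _ (hm' a b))).2
  simp only [Prod.smul_mk, smul_eq_mul, mul_zero, sub_zero, map_mul, mul_one, hxv, hxv',
    valuation_unif, valuation_unif_zpow, ← exp_add, exp_le_exp] at e1 e2 e3 e4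
  rw [← exp_zero, exp_le_exp] at e1 e3
  obtain ⟨e1, e1'⟩ := e1
  obtain ⟨e3, e3'⟩ := e3
  rw [mul_comm b, ← mul_sub, map_mul, hxv] at e1'
  rw [hab, hab'] at hne
  replace hne := fun h => hne (normalClass_eq_iff.2 h)
  have hn01 : n = 0 ∨ n = 1 := by omega
  rcases hn01 with rfl | rfl
  · rw [neg_zero, exp_zero, one_mul, Valuation.map_sub_swap] at e1'
    have haa : a' = a + 1 := by
      by_contra hcon
      exact hne ⟨by omega, e1'⟩
    refine ⟨a, b', Or.inl ⟨?_, by rw [hab', haa]⟩⟩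
    exact hab.trans (normalClass_eq_iff.2 ⟨rfl, e1'⟩)
  · have hb : p.valuation K (b' - b) ≤ exp (-(a - 1)) := by
      have : p.valuation K (b' - b) = exp 1 * (exp (-1) * p.valuation K (b' - b)) := by
        rw [← mul_assoc, ← exp_add]; simp
      rw [this, show -(a - 1) = 1 + -a by ring, exp_add]
      gcongr
    have hb2 : p.valuation K (b - b') ≤ exp (-a') := by
      rw [show ((x⁻¹ : Kˣ) : K) * (unif p * b) - b' * (((x⁻¹ : Kˣ) : K) * unif p) =
        ((x⁻¹ : Kˣ) : K) * unif p * (b - b') by ring, map_mul, map_mul, hxv', valuation_unif,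
        ← exp_add] at e3'
      simpa using e3'
    have haa : a = a' + 1 := by
      by_contra hcon
      exact hne ⟨by omega, by rw [show a = a' by omega]; exact hb2⟩
    refine ⟨a', b, Or.inr ⟨?_, by rw [hab, haa]⟩⟩
    exact hab'.trans (normalClass_eq_iff.2 ⟨rfl, by rw [Valuation.map_sub_swap]; exact hb2⟩)

theorem isDist_normalForm (a : ℤ) (b : K) :
    IsDist (normalForm p a b) (normalForm p (a + 1) b) 1 := by
  let b₁ : ∀ a, Module.Basis (Fin 2) (LocalRing p) (normalForm p a b).1 := fun a =>
    Module.Basis.span (linearIndependent_normalForm p a b)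
  have e : ∀ a i, (b₁ a i : K × K) = ![((unif p : K) ^ a, (0 : K)), (b, 1)] i := fun a i =>
    congrArg Subtype.val (Module.Basis.span_apply (linearIndependent_normalForm p a b) i)
  refine ⟨b₁ a, b₁ (a + 1), ![1, 0], fun i => (e _ i).trans ?_, by simp⟩
  refine Eq.trans ?_ (congrArg (fun z : K × K => unif p ^ (![1, 0] : Fin 2 → ℤ) i • z) (e a i)).symm
  fin_cases i
  · simp [zpow_add_one₀ (unif_ne_zero p), mul_comm]
  · simp

theorem treeGraph_adj_normalClass (a : ℤ) (b : K) :
    (treeGraph p).Adj (normalClass p a b) (normalClass p (a + 1) b) := by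
  rw [treeGraph, SimpleGraph.fromRel_adj]
  refine ⟨fun h => ?_, Or.inl ⟨_, _, rfl, rfl, isDist_normalForm a b⟩⟩
  have := (normalClass_eq_iff.1 h).1
  omega

/-- Every edge of the tree joins the classes of two lattices with the bases `(π ^ a, 0), (b, 1)`
and `(π ^ (a + 1), 0), (b, 1)`. -/
theorem exists_normalClass_of_adj {c₁ c₂ : LatticeClass p} (h : (treeGraph p).Adj c₁ c₂) :
    ∃ a b, (c₁ = normalClass p a b ∧ c₂ = normalClass p (a + 1) b) ∨
      (c₂ = normalClass p a b ∧ c₁ = normalClass p (a + 1) b) := by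
  rw [treeGraph, SimpleGraph.fromRel_adj] at h
  obtain ⟨hne, ⟨L₁, L₂, rfl, rfl, hL⟩ | ⟨L₁, L₂, rfl, rfl, hL⟩⟩ := h
  · exact hL.exists_normalClass hne
  · obtain ⟨a, b, h⟩ := hL.exists_normalClass hne.symm
    exact ⟨a, b, h.symm⟩

variable (p) in
/-- The point `(1 - t) u + t v` of the edge from `u = [(π ^ a, 0), (b, 1)]` to
`v = [(π ^ (a + 1), 0), (b, 1)]`. -/
def treePoint (a : ℤ) (b : K) (t : I) : Tree p := edgePoint (treeGraph_adj_normalClass a b) t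

theorem exists_eq_treePoint (q : Tree p) : ∃ a b t, q = treePoint p a b t := by
  obtain ⟨u, v, t, ht, huv, hq⟩ := q.mem_edge
  rcases huv with rfl | huv
  · obtain ⟨a, b, rfl⟩ := exists_eq_normalClass u
    refine ⟨a, b, 0, Realization.ext ?_⟩
    rw [hq, ← Finsupp.single_add]
    simp [treePoint, edgePoint]
  · obtain ⟨a, b, ⟨rfl, rfl⟩ | ⟨rfl, rfl⟩⟩ := exists_normalClass_of_adj huv
    · exact ⟨a, b, ⟨t, ht⟩, Realization.ext hq⟩
    · refine ⟨a, b, ⟨1 - t, by rw [Set.mem_Icc] at ht ⊢; constructor <;> linarith⟩,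
        Realization.ext ?_⟩
      rw [hq]
      simp [treePoint, edgePoint, add_comm]

theorem treePoint_eq_of_le {a : ℤ} {b b' : K}
    (h : p.valuation K (b - b') ≤ exp (-(a + 1))) (t : I) :
    treePoint p a b t = treePoint p a b' t := by
  apply Realization.ext
  have h1 : normalClass p (a + 1) b = normalClass p (a + 1) b' := normalClass_eq_iff.2 ⟨rfl, h⟩
  have h2 : normalClass p a b = normalClass p a b' :=
    normalClass_eq_iff.2 ⟨rfl, h.trans (exp_le_exp.2 (by omega))⟩
  simp [treePoint, edgePoint, h1, h2]

theorem continuous_treePoint (a : ℤ) (b : K) : Continuous (treePoint p a b) :=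
  continuous_edgePoint (treeGraph_adj_normalClass a b)

theorem matrixMap_smul_normalClass (x : K) (y : Kˣ) (a : ℤ) (b : K) :
    matrixMap x y • normalClass p a b = normalClass p (a + ord p (y : K)) (y * b + x) :=
  congrArg (Quotient.mk _) (matrixMap_smul_normalForm x y a b)

variable {w : Kˣ}

theorem smul_tree_coord (g : Gw w) (q : Tree p) :
    (g • q).coord = q.coord.mapDomain fun c => matrixMap g.x g.y • c := rfl

theorem smul_treePoint (g : Gw w) (a : ℤ) (b : K) (t : I) :
    g • treePoint p a b t = treePoint p (a + ord p (g.y : K)) (g.y * b + g.x) t := by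
  apply Realization.ext
  rw [smul_tree_coord]
  simp only [treePoint, edgePoint, Finsupp.mapDomain_add, Finsupp.mapDomain_single,
    matrixMap_smul_normalClass]
  rw [show a + 1 + ord p (g.y : K) = a + ord p (g.y : K) + 1 by ring]

theorem smul_vertex_normalClass (g : Gw w) (a : ℤ) (b : K) :
    g • (vertex (treeGraph p) (normalClass p a b) : Tree p) =
      vertex (treeGraph p) (normalClass p (a + ord p (g.y : K)) (g.y * b + g.x)) := by
  apply Realization.ext
  rw [smul_tree_coord]
  simp only [vertex, Finsupp.mapDomain_single, matrixMap_smul_normalClass]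

theorem edist_smul_tree_le (g : Gw w) (q q' : Tree p) : edist (g • q) (g • q') ≤ edist q q' :=
  Realization.edist_smul_le (treeAut p (toGL (w := w) g)) q q'

theorem edist_normalClass_add_ne_top (a : ℤ) (b : K) (n : ℕ) :
    edist (vertex (treeGraph p) (normalClass p a b))
      (vertex (treeGraph p) (normalClass p (a + n) b)) ≠ ∞ := by
  induction n with
  | zero => simp
  | succ n ih =>
    refine ne_top_of_le_ne_top (ENNReal.add_ne_top.2 ⟨ih, ENNReal.one_ne_top⟩)
      ((edist_triangle _ _ _).trans (add_le_add_right (edist_vertex_le_one ?_) _))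
    rw [Nat.cast_succ, ← add_assoc]
    exact treeGraph_adj_normalClass _ _

theorem edist_normalClass_ne_top (a a' : ℤ) (b : K) :
    edist (vertex (treeGraph p) (normalClass p a b))
      (vertex (treeGraph p) (normalClass p a' b)) ≠ ∞ := by
  rcases le_total a a' with h | h
  · obtain ⟨n, rfl⟩ := Int.le.dest h
    exact edist_normalClass_add_ne_top a b n
  · obtain ⟨n, rfl⟩ := Int.le.dest h
    rw [edist_comm]
    exact edist_normalClass_add_ne_top a' b n

theorem edist_vertex_base_ne_top (a : ℤ) (b : K) :
    edist (vertex (treeGraph p) (normalClass p a b))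
      (vertex (treeGraph p) (normalClass p 0 0)) ≠ ∞ := by
  obtain ⟨a', ha'⟩ : ∃ a' : ℤ, normalClass p a' b = normalClass p a' 0 := by
    refine ⟨ord p b, normalClass_eq_iff.2 ⟨rfl, ?_⟩⟩
    rw [sub_zero]
    by_cases hb : b = 0
    · simp [hb]
    · rw [valuation_eq_exp_ord p hb]
  have h1 := edist_normalClass_ne_top (p := p) a a' b
  rw [ha'] at h1
  exact ne_top_of_le_ne_top (ENNReal.add_ne_top.2 ⟨h1, edist_normalClass_ne_top a' 0 0⟩)
    (edist_triangle _ _ _)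

/-- The tree is connected: every vertex `(a, b)` is joined by edges to a vertex `(a', b)` with
`a' ≤ v(b)`, which is the vertex `(a', 0)`. -/
theorem edist_tree_ne_top (q q' : Tree p) : edist q q' ≠ ∞ := by
  have key : ∀ q : Tree p, edist q (vertex (treeGraph p) (normalClass p 0 0)) ≠ ∞ := by
    intro q
    obtain ⟨a, b, t, rfl⟩ := exists_eq_treePoint q
    have h0 : vertex (treeGraph p) (normalClass p a b) = treePoint p a b 0 :=
      Realization.ext (by simp [vertex, treePoint, edgePoint])
    refine ne_top_of_le_ne_top (ENNReal.add_ne_top.2 ⟨?_, edist_vertex_base_ne_top a b⟩)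
      (edist_triangle _ _ _)
    rw [h0]
    exact ne_top_of_le_ne_top (edist_ne_top t 0) (edist_edgePoint_le _ _ _)
  exact ne_top_of_le_ne_top (ENNReal.add_ne_top.2 ⟨key q, by rw [edist_comm]; exact key q'⟩)
    (edist_triangle _ _ _)

/-! ### Height and depth of a lattice class -/

/-- The height of the class of the lattice with the basis `(π ^ a, 0)`, `(b, 1)` is `a`. -/
def height (c : LatticeClass p) : ℤ := (exists_eq_normalClass c).choose

theorem height_normalClass (a : ℤ) (b : K) : height (normalClass p a b) = a := by
  obtain ⟨b', hb'⟩ := (exists_eq_normalClass (normalClass p a b)).choose_spec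
  exact (normalClass_eq_iff.1 hb').1.symm

theorem abs_height_sub_le {c₁ c₂ : LatticeClass p} (h : (treeGraph p).Adj c₁ c₂) :
    |(height c₁ : ℝ) - height c₂| ≤ 1 := by
  obtain ⟨a, b, ⟨rfl, rfl⟩ | ⟨rfl, rfl⟩⟩ := exists_normalClass_of_adj h <;>
  simp [height_normalClass]

/-- The depth of the class of the lattice with the basis `(π ^ a, 0)`, `(b, 1)` is
`-min(a, v(b))`. -/
def depth (c : LatticeClass p) : ℤ :=
  log (max (exp (-(exists_eq_normalClass c).choose))
    (p.valuation K (exists_eq_normalClass c).choose_spec.choose))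

theorem depth_normalClass (a : ℤ) (b : K) :
    depth (normalClass p a b) = log (max (exp (-a)) (p.valuation K b)) := by
  have h := (exists_eq_normalClass (normalClass p a b)).choose_spec.choose_spec
  rw [depth]
  set a' := (exists_eq_normalClass (normalClass p a b)).choose
  set b' := (exists_eq_normalClass (normalClass p a b)).choose_spec.choose
  obtain ⟨ha, hb⟩ := normalClass_eq_iff.1 h
  rw [← ha]
  have key : ∀ b b' : K, p.valuation K (b - b') ≤ exp (-a) →
      max (exp (-a)) (p.valuation K b) ≤ max (exp (-a)) (p.valuation K b') := by
    intro b b' hb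
    refine max_le (le_max_left _ _) ?_
    have : b = (b - b') + b' := by ring
    rw [this]
    exact (Valuation.map_add _ _ _).trans (max_le_max_right _ hb)
  congr 1
  exact le_antisymm (key _ _ (by rwa [Valuation.map_sub_swap])) (key _ _ hb)

theorem abs_depth_sub_le {c₁ c₂ : LatticeClass p} (h : (treeGraph p).Adj c₁ c₂) :
    |(depth c₁ : ℝ) - depth c₂| ≤ 1 := by
  have key : ∀ (a : ℤ) (b : K), depth (normalClass p (a + 1) b) ≤ depth (normalClass p a b) ∧
      depth (normalClass p a b) ≤ depth (normalClass p (a + 1) b) + 1 := by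
    intro a b
    have hne : ∀ a : ℤ, max (exp (-a)) (p.valuation K b) ≠ 0 := fun a =>
      (lt_of_lt_of_le exp_pos (le_max_left _ _)).ne'
    rw [depth_normalClass, depth_normalClass]
    constructor
    · rw [← exp_le_exp, exp_log (hne _), exp_log (hne _)]
      exact max_le_max_right _ (exp_le_exp.2 (by omega))
    · rw [← exp_le_exp, exp_add, exp_log (hne _), exp_log (hne _)]
      refine max_le ?_ ?_
      · refine le_trans ?_ (mul_le_mul_left (le_max_left _ _) _)
        rw [← exp_add, exp_le_exp]; omega
      · refine (le_max_right _ _).trans (le_mul_of_one_le_right zero_le ?_)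
        rw [← exp_zero, exp_le_exp]; omega
  have hab : ∀ m n : ℤ, m ≤ n → n ≤ m + 1 → |(n : ℝ) - m| ≤ 1 := by
    intro m n h1 h2
    have : |n - m| ≤ 1 := abs_le.2 ⟨by omega, by omega⟩
    exact_mod_cast this
  obtain ⟨a, b, ⟨rfl, rfl⟩ | ⟨rfl, rfl⟩⟩ := exists_normalClass_of_adj h
  · exact hab _ _ (key a b).1 (key a b).2
  · rw [abs_sub_comm]
    exact hab _ _ (key a b).1 (key a b).2

/-! ### The Busemann function is `1`-Lipschitz -/

theorem stdLattice_eq (n : ℤ) : stdLattice p n = normalForm p (-n) (0 : K) := by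
  apply Subtype.ext
  change Submodule.span _ _ = Submodule.span _ _
  rw [Matrix.range_cons, Matrix.range_cons, Matrix.range_empty, Set.union_empty,
    Set.singleton_union]

/-- The sequence that defines the Busemann function is monotone, since consecutive lattices on the
ray are adjacent, and bounded by the distance from the point to `[L_𝔭(0)]`, since the height is
`1`-Lipschitz. -/
theorem tendsto_busemann (q : Tree p) : Filter.Tendsto (fun n : ℕ =>
    (n : ℝ) - (edist q (vertex (treeGraph p) ⟦stdLattice p n⟧)).toReal) Filter.atTop
    (nhds (busemann p q)) := by
  have hcls : ∀ n : ℕ, (⟦stdLattice p n⟧ : LatticeClass p) = normalClass p (-n) 0 := fun n =>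
    congrArg (Quotient.mk _) (stdLattice_eq _)
  refine tendsto_nhds_limUnder ⟨_, tendsto_atTop_ciSup (monotone_nat_of_le_succ fun n => ?_)
    ⟨(edist q (vertex (treeGraph p) (normalClass p 0 0))).toReal, ?_⟩⟩
  · have h1 : edist q (vertex (treeGraph p) ⟦stdLattice p ((n + 1 : ℕ) : ℤ)⟧) ≤
        edist q (vertex (treeGraph p) ⟦stdLattice p n⟧) + 1 := by
      refine (edist_triangle _ _ _).trans (add_le_add_right (edist_vertex_le_one ?_) _)
      rw [hcls, hcls]
      have := treeGraph_adj_normalClass (p := p) (-((n + 1 : ℕ) : ℤ)) (0 : K)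
      rw [show -((n + 1 : ℕ) : ℤ) + 1 = -(n : ℤ) by push_cast; ring] at this
      exact this.symm
    have h2 := ENNReal.toReal_mono
      (ENNReal.add_ne_top.2 ⟨edist_tree_ne_top _ _, ENNReal.one_ne_top⟩) h1
    rw [ENNReal.toReal_add (edist_tree_ne_top _ _) ENNReal.one_ne_top, ENNReal.toReal_one] at h2
    push_cast at h2 ⊢
    linarith
  · rintro _ ⟨n, rfl⟩
    have h1 := (ofReal_abs_affineExt_sub_le (G := treeGraph p) (h := fun c => (height c : ℝ))
      (fun _ _ h => abs_height_sub_le h) (vertex _ (normalClass p 0 0))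
        (vertex _ (normalClass p (-(n : ℤ)) 0))).trans (edist_triangle_left _ _ q)
    rw [affineExt_vertex, affineExt_vertex, height_normalClass, height_normalClass] at h1
    have h2 := ENNReal.toReal_mono
      (ENNReal.add_ne_top.2 ⟨edist_tree_ne_top _ _, edist_tree_ne_top _ _⟩) h1
    rw [ENNReal.toReal_add (edist_tree_ne_top _ _) (edist_tree_ne_top _ _),
      ENNReal.toReal_ofReal (abs_nonneg _)] at h2
    simp only [Int.cast_zero, Int.cast_neg, zero_sub, neg_neg, Int.cast_natCast, Nat.abs_cast] at h2
    simp only [hcls]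
    linarith

theorem continuous_busemann : Continuous (busemann p) := by
  refine LipschitzWith.continuous (K := 1) fun q q' => ?_
  rw [ENNReal.coe_one, one_mul, edist_dist, Real.dist_eq]
  refine ENNReal.ofReal_le_of_le_toReal ?_
  refine le_of_tendsto ((tendsto_busemann q).sub (tendsto_busemann q')).abs
    (Filter.Eventually.of_forall fun n => ?_)
  have key : ∀ q q' r : Tree p,
      (edist q r).toReal ≤ (edist q q').toReal + (edist q' r).toReal := by
    intro q q' r
    rw [← ENNReal.toReal_add (edist_tree_ne_top _ _) (edist_tree_ne_top _ _)]
    exact ENNReal.toReal_mono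
      (ENNReal.add_ne_top.2 ⟨edist_tree_ne_top _ _, edist_tree_ne_top _ _⟩) (edist_triangle _ _ _)
  have h1 := key q q' (vertex _ ⟦stdLattice p n⟧)
  have h2 := key q' q (vertex _ ⟦stdLattice p n⟧)
  rw [edist_comm q' q] at h2
  rw [abs_le]
  constructor <;> linarith

end Adjacency

/-! ### Comparison of the distance of a warped product with the distances of the factors -/

section WarpedDistance

variable {M N : Type*} [PseudoEMetricSpace M] [PseudoEMetricSpace N] {f : M → ℝ}

theorem sq_rpow_half (x : ℝ≥0∞) : (x ^ 2) ^ (1 / 2 : ℝ) = x := by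
  rw [← ENNReal.rpow_natCast, ← ENNReal.rpow_mul]; norm_num

theorem le_sqrt_add_sq_left (x y : ℝ≥0∞) : x ≤ (x ^ 2 + y ^ 2) ^ (1 / 2 : ℝ) := by
  conv_lhs => rw [← sq_rpow_half x]
  exact ENNReal.rpow_le_rpow le_self_add (by norm_num)

theorem le_sqrt_add_sq_right (x y : ℝ≥0∞) : y ≤ (x ^ 2 + y ^ 2) ^ (1 / 2 : ℝ) := by
  rw [add_comm]; exact le_sqrt_add_sq_left y x

theorem sqrt_add_sq_le (x y : ℝ≥0∞) : (x ^ 2 + y ^ 2) ^ (1 / 2 : ℝ) ≤ x + y := by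
  rw [← sq_rpow_half (x + y)]
  refine ENNReal.rpow_le_rpow ?_ (by norm_num)
  rw [add_sq, add_right_comm]
  exact le_self_add

theorem warpedSum_cons_cons (γ : I → M × N) (s t : I) (l : List I) :
    warpedSum f γ (s :: t :: l) =
      (edist (γ s).1 (γ t).1 ^ 2 +
        (ENNReal.ofReal (f (γ s).1) * edist (γ s).2 (γ t).2) ^ 2) ^ (1 / 2 : ℝ) +
      warpedSum f γ (t :: l) := by
  rw [warpedSum, mul_pow]

theorem edist_fst_le_warpedSum (γ : I → M × N) (l : List I) :
    ∀ s, ∀ t ∈ s :: l, edist (γ s).1 (γ t).1 ≤ warpedSum f γ (s :: l) := by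
  induction l with
  | nil => intro s t ht; simp at ht; simp [ht]
  | cons r l ih =>
    intro s t ht
    rcases List.mem_cons.1 ht with rfl | ht
    · simp
    · rw [warpedSum_cons_cons]
      exact (edist_triangle _ (γ r).1 _).trans
        (add_le_add (le_sqrt_add_sq_left _ _) (ih r t ht))

/-- If `c ≤ f` on a ball, then a sum for the length of a path in this ball bounds `c` times the
distances in the second factor. -/
theorem mul_edist_snd_le_warpedSum (γ : I → M × N) {x : M} {ε : ℝ≥0∞} {c : ℝ}
    (hc : ∀ y, edist x y < ε → c ≤ f y) (l : List I) :
    ∀ s, edist x (γ s).1 + warpedSum f γ (s :: l) < ε → ∀ t ∈ s :: l,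
      ENNReal.ofReal c * edist (γ s).2 (γ t).2 ≤ warpedSum f γ (s :: l) := by
  induction l with
  | nil => intro s _ t ht; simp at ht; simp [ht]
  | cons r l ih =>
    intro s hs t ht
    rcases List.mem_cons.1 ht with rfl | ht
    · simp
    · rw [warpedSum_cons_cons] at hs ⊢
      have h1 : edist x (γ r).1 + warpedSum f γ (r :: l) < ε := by
        refine lt_of_le_of_lt ?_ hs
        rw [← add_assoc]
        gcongr
        exact (edist_triangle _ (γ s).1 _).trans (by gcongr; exact le_sqrt_add_sq_left _ _)
      have h2 : c ≤ f (γ s).1 := hc _ (lt_of_le_of_lt le_self_add hs)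
      calc ENNReal.ofReal c * edist (γ s).2 (γ t).2
          ≤ ENNReal.ofReal c * (edist (γ s).2 (γ r).2 + edist (γ r).2 (γ t).2) := by
            gcongr; exact edist_triangle _ _ _
        _ = ENNReal.ofReal c * edist (γ s).2 (γ r).2 +
            ENNReal.ofReal c * edist (γ r).2 (γ t).2 := mul_add _ _ _
        _ ≤ _ := by
          refine add_le_add (le_trans ?_ (le_sqrt_add_sq_right _ _)) (ih r h1 t ht)
          gcongr

/-- The list of the points of a partition starts with `0`. -/
theorem exists_sort_eq_cons (s : Finset I) : ∃ l : List I,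
    Finset.sort (insert 0 (insert 1 s)) (· ≤ ·) = 0 :: l ∧ 1 ∈ 0 :: l := by
  have h0 : (0 : I) ∈ Finset.sort (insert 0 (insert 1 s)) (· ≤ ·) := by simp
  have h1 : (1 : I) ∈ Finset.sort (insert 0 (insert 1 s)) (· ≤ ·) := by simp
  have hp := Finset.pairwise_sort (insert 0 (insert 1 s)) (fun a b : I => a ≤ b)
  cases hl : Finset.sort (insert 0 (insert 1 s)) (fun a b : I => a ≤ b) with
  | nil => rw [hl] at h0; simp at h0
  | cons a l =>
    rw [hl] at h0 h1 hp
    have ha : a = 0 := by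
      rcases List.mem_cons.1 h0 with h | h
      · exact h.symm
      · exact le_antisymm ((List.pairwise_cons.1 hp).1 _ h) a.2.1
    subst ha
    exact ⟨l, rfl, h1⟩

/-- Points at distance less than `ε` in the warped product have distance less than `ε` in the first
factor, and distance less than `ε / c` in the second factor if `c ≤ f` on the ball with radius `ε`.
Only one partition of a path of length less than `ε` is needed. -/
theorem edist_lt_of_warpedEDist_lt {a b : M × N} {ε : ℝ≥0∞} {c : ℝ}
    (hc : ∀ y, edist a.1 y < ε → c ≤ f y) (h : warpedEDist f a b < ε) :
    edist a.1 b.1 < ε ∧ ENNReal.ofReal c * edist a.2 b.2 < ε := by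
  obtain ⟨γ, hγ⟩ := iInf_lt_iff.1 h
  obtain ⟨s, hs⟩ := (Filter.eventually_lt_of_limsup_lt hγ).exists
  obtain ⟨l, hl, h1⟩ := exists_sort_eq_cons s
  rw [hl] at hs
  have e1 := edist_fst_le_warpedSum (f := f) γ l 0 1 h1
  have e2 := mul_edist_snd_le_warpedSum γ hc l 0 (by simpa using hs) 1 h1
  rw [γ.source, γ.target] at e1 e2
  exact ⟨e1.trans_lt hs, e2.trans_lt hs⟩

theorem warpedSum_le (γ : I → M × N) {C : ℝ≥0∞}
    (hγ : ∀ s t, edist (γ s).1 (γ t).1 + ENNReal.ofReal (f (γ s).1) * edist (γ s).2 (γ t).2 ≤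
      C * edist s t) (l : List I) :
    ∀ s, (s :: l).Pairwise (· ≤ ·) → warpedSum f γ (s :: l) ≤ C * edist s 1 := by
  induction l with
  | nil => intro s _; simp [warpedSum]
  | cons r l ih =>
    intro s hs
    rw [warpedSum_cons_cons]
    have hsr : s ≤ r := (List.pairwise_cons.1 hs).1 r (by simp)
    have e : edist s 1 = edist s r + edist r 1 := by
      have h1 : (s : ℝ) ≤ r := hsr
      have h2 : (r : ℝ) ≤ 1 := r.2.2
      simp only [edist_dist, Subtype.dist_eq, Real.dist_eq, Set.Icc.coe_one]
      rw [← ENNReal.ofReal_add (abs_nonneg _) (abs_nonneg _), abs_of_nonpos (by linarith),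
        abs_of_nonpos (by linarith), abs_of_nonpos (by linarith)]
      congr 1; ring
    rw [e, mul_add]
    exact add_le_add ((sqrt_add_sq_le _ _).trans (hγ s r)) (ih r (List.pairwise_cons.1 hs).2)

theorem warpedEDist_le {a b : M × N} (γ : Path a b) {C : ℝ≥0∞}
    (hγ : ∀ s t, edist (γ s).1 (γ t).1 + ENNReal.ofReal (f (γ s).1) * edist (γ s).2 (γ t).2 ≤
      C * edist s t) : warpedEDist f a b ≤ C := by
  refine (iInf_le _ γ).trans (Filter.limsup_le_of_le (by isBoundedDefault)
    (Filter.Eventually.of_forall fun s => ?_))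
  have hp := Finset.pairwise_sort (insert 0 (insert 1 s)) (fun a b : I => a ≤ b)
  obtain ⟨l, hl, -⟩ := exists_sort_eq_cons s
  rw [hl] at hp ⊢
  refine (warpedSum_le γ hγ l 0 hp).trans_eq ?_
  simp [edist_dist, Subtype.dist_eq]

theorem warpedEDist_le_of_lipschitz {a b : M × N} {γ : I → M × N} (h0 : γ 0 = a) (h1 : γ 1 = b)
    {C D : NNReal} {F : ℝ} (hC : LipschitzWith C fun t => (γ t).1)
    (hD : LipschitzWith D fun t => (γ t).2) (hF : ∀ t, f (γ t).1 ≤ F) :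
    warpedEDist f a b ≤ C + ENNReal.ofReal F * D := by
  refine warpedEDist_le ⟨⟨γ, hC.continuous.prodMk hD.continuous⟩, h0, h1⟩ fun s t => ?_
  rw [add_mul, mul_assoc]
  exact add_le_add (hC s t) (mul_le_mul' (ENNReal.ofReal_le_ofReal (hF s)) (hD s t))

end WarpedDistance

/-! ### The topology of `Y_w` -/

section Topology

open Filter Topology

variable {K : Type*} [Field K] [NumberField K] {w : Kˣ} (c : Choices w)

theorem yp_ne_zero (p : primes w) : c.yp p ≠ 0 := by
  obtain ⟨m, -, hm⟩ := c.yp_spec p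
  intro h
  rw [h, Ideal.span_singleton_eq_bot.2 rfl] at hm
  exact pow_ne_zero m p.1.ne_bot hm.symm

theorem warping_pos (v : InfinitePlace K) (a : Xw w) : 0 < warping c v a := by
  refine mul_pos (Finset.prod_pos fun i _ => Real.rpow_pos_of_pos ?_ _)
    (Finset.prod_pos fun p _ => Real.rpow_pos_of_pos ?_ _)
  · exact v.pos_iff.2 (by simp)
  · exact v.pos_iff.2 (by simpa using yp_ne_zero c p)

theorem continuous_warping (v : InfinitePlace K) : Continuous (warping c v) := by
  refine Continuous.mul (continuous_finsetProd _ fun i _ => ?_)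
    (continuous_finsetProd _ fun p _ => ?_)
  · refine Continuous.rpow continuous_const (g := fun a : Xw w => -(a.fst i)) ?_ fun _ => Or.inl ?_
    · exact ((PiLp.continuous_apply 2 _ i).comp (WithLp.continuous_fst 2 _ _)).neg
    · exact (v.pos_iff.2 (by simp)).ne'
  · refine Continuous.rpow continuous_const ?_ fun _ => Or.inl ?_
    · exact (continuous_busemann.comp
        ((PiLp.continuous_apply 2 _ p).comp (WithLp.continuous_snd 2 _ _))).div_const _
    · exact (v.pos_iff.2 (by simpa using yp_ne_zero c p)).ne'

variable (w) in
/-- The product `ℝ^{n_w} × ∏_𝔭 T(v_𝔭) × ∏_{[τ]} K_{ℝ,[τ]}`, with the product topology. -/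
abbrev Coord : Type _ :=
  (EuclideanSpace ℝ (Fin (Units.rank K)) × (∀ p : primes w, Tree p.1)) ×
    (∀ v : InfinitePlace K, Mink v)

/-- The point of `X_w` with the given coordinates. -/
def toXw (a : EuclideanSpace ℝ (Fin (Units.rank K)) × (∀ p : primes w, Tree p.1)) : Xw w :=
  WithLp.toLp 2 (a.1, WithLp.toLp 2 a.2)

/-- The point of `Y_w` with the given coordinates. -/
def ofCoord (a : Coord w) : Yw c := ⟨fun v => (toXw a.1, a.2 v), fun _ _ => rfl⟩

theorem ofCoord_surjective : Function.Surjective (ofCoord c) := by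
  intro b
  obtain ⟨v₀⟩ : Nonempty (InfinitePlace K) := inferInstance
  refine ⟨(((b.pt v₀).1.fst, fun p => (b.pt v₀).1.snd p), fun v => (b.pt v).2), ?_⟩
  exact Yw.ext (funext fun v => Prod.ext (b.compat v₀ v) rfl)

/-- Points of `X_w` with close coordinates are joined by a path with a small Lipschitz constant. -/
theorem exists_lipschitz_toXw : ∃ A : NNReal, ∀ (C : NNReal)
    (a b : EuclideanSpace ℝ (Fin (Units.rank K)) × (∀ p : primes w, Tree p.1)),
    edist a.1 b.1 < C → (∀ p, edist (a.2 p) (b.2 p) < C) →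
    ∃ γ : I → Xw w, γ 0 = toXw a ∧ γ 1 = toXw b ∧ LipschitzWith (A * C) γ := by
  obtain ⟨A₁, h₁⟩ : ∃ A : NNReal, LipschitzWith A
      (@WithLp.toLp 2 (EuclideanSpace ℝ (Fin (Units.rank K)) ×
        PiLp 2 fun p : primes w => Tree p.1)) := ⟨_, WithLp.prod_lipschitzWith_toLp 2 _ _⟩
  obtain ⟨A₂, h₂⟩ : ∃ A : NNReal, LipschitzWith A
      (@WithLp.toLp 2 (∀ p : primes w, Tree p.1)) := ⟨_, PiLp.lipschitzWith_toLp 2 _⟩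
  refine ⟨A₁ * max 1 A₂, fun C a b h1 h2 => ?_⟩
  choose g g0 g1 gl using fun p => Realization.exists_lipschitz_path (h2 p)
  refine ⟨fun t => toXw (AffineMap.lineMap a.1 b.1 (t : ℝ), fun p => g p t), ?_, ?_, ?_⟩
  · simp [g0]
  · simp [g1]
  · have e1 : LipschitzWith C fun t : I => AffineMap.lineMap (k := ℝ) a.1 b.1 (t : ℝ) := by
      have := (lipschitzWith_lineMap (𝕜 := ℝ) a.1 b.1).comp (LipschitzWith.subtype_val I)
      rw [mul_one] at this
      refine this.weaken ?_
      rw [edist_nndist] at h1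
      exact_mod_cast h1.le
    have e2 : LipschitzWith C fun t : I => fun p => g p t := fun s t =>
      edist_pi_le_iff.2 fun p => gl p s t
    have e3 := h₁.comp (e1.prodMk (h₂.comp e2))
    refine e3.weaken ?_
    rw [mul_assoc]
    gcongr
    rw [max_mul_of_nonneg _ _ zero_le, one_mul]

theorem Yw.edist_le {a b : Yw c} {δ : ℝ≥0∞}
    (h : ∀ v, warpedEDist (warping c v) (a.pt v) (b.pt v) ≤ δ) :
    Yw.edist a b ≤ Fintype.card (InfinitePlace K) * δ := by
  rw [Yw.edist, ← sq_rpow_half (_ * δ)]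
  refine ENNReal.rpow_le_rpow ((Finset.sum_le_sum fun v _ => pow_le_pow_left' (h v) 2).trans ?_)
    (by norm_num)
  rw [Finset.sum_const, Finset.card_univ, nsmul_eq_mul, mul_pow]
  gcongr
  exact_mod_cast Nat.le_self_pow two_ne_zero _

theorem Yw.warpedEDist_le_edist (a b : Yw c) (v : InfinitePlace K) :
    warpedEDist (warping c v) (a.pt v) (b.pt v) ≤ Yw.edist a b := by
  rw [Yw.edist]
  conv_lhs => rw [← sq_rpow_half (warpedEDist _ _ _)]
  exact ENNReal.rpow_le_rpow (Finset.single_le_sum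
    (f := fun v => warpedEDist (warping c v) (a.pt v) (b.pt v) ^ 2)
    (fun _ _ => zero_le) (Finset.mem_univ v)) (by norm_num)

/-- The topology of `Y_w` is coarser than the product topology: nearby points are joined by
Lipschitz paths on which the warping function is bounded. -/
theorem continuous_ofCoord : Continuous (ofCoord c) := by
  suffices h : ∀ a : Coord w, ∀ ε : ℝ≥0∞, 0 < ε →
      ∀ᶠ b in 𝓝 a, Yw.edist (ofCoord c a) (ofCoord c b) < ε by
    refine continuous_def.2 fun U hU => isOpen_iff_mem_nhds.2 fun a ha => ?_
    obtain ⟨ε, hε, hU⟩ := hU _ ha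
    exact (h a ε hε).mono fun b hb => hU _ hb
  intro a ε hε
  obtain ⟨A, hA⟩ := exists_lipschitz_toXw (w := w)
  -- The warping functions are bounded by `F` on the ball with radius `η`.
  obtain ⟨F, hF⟩ : ∃ F : NNReal, ∀ v, warping c v (toXw a.1) < F := by
    obtain ⟨F, hF⟩ := (Set.finite_range fun v => warping c v (toXw a.1)).bddAbove
    refine ⟨(max F 0 + 1).toNNReal, fun v => ?_⟩
    rw [Real.coe_toNNReal _ (by positivity)]
    linarith [hF ⟨v, rfl⟩, le_max_left F 0]
  obtain ⟨η, hη, hηF⟩ : ∃ η : ℝ≥0∞, 0 < η ∧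
      ∀ x, edist x (toXw a.1) < η → ∀ v, warping c v x ≤ F := by
    have : ∀ᶠ x in 𝓝 (toXw a.1), ∀ v, warping c v x ≤ F := by
      rw [eventually_all]
      exact fun v => ((continuous_warping c v).tendsto _).eventually_le_const (hF v)
    exact EMetric.mem_nhds_iff.1 this
  obtain ⟨δ, hδ, hδη, hδε⟩ : ∃ δ : NNReal, 0 < δ ∧ (A * δ : ℝ≥0∞) < η ∧
      Fintype.card (InfinitePlace K) * (A * δ + F * δ : ℝ≥0∞) < ε := by
    have t1 : Tendsto (fun δ : NNReal => (A * δ : ℝ≥0∞)) (𝓝[>] 0) (𝓝 0) := by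
      have : Continuous fun δ : NNReal => ((A * δ : NNReal) : ℝ≥0∞) := by fun_prop
      simpa using (this.tendsto 0).mono_left nhdsWithin_le_nhds
    have t2 : Tendsto (fun δ : NNReal => (Fintype.card (InfinitePlace K) *
        (A * δ + F * δ : ℝ≥0∞) : ℝ≥0∞)) (𝓝[>] 0) (𝓝 0) := by
      have : Continuous fun δ : NNReal =>
        ((Fintype.card (InfinitePlace K) * (A * δ + F * δ) : NNReal) : ℝ≥0∞) := by fun_prop
      simpa using (this.tendsto 0).mono_left nhdsWithin_le_nhds
    obtain ⟨δ, ⟨h1, h2⟩, h3⟩ := (((t1.eventually_lt_const hη).and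
      (t2.eventually_lt_const hε)).and self_mem_nhdsWithin).exists
    exact ⟨δ, h3, h1, h2⟩
  have hδ' : (0 : ℝ≥0∞) < δ := by exact_mod_cast hδ
  have n1 : ∀ᶠ b : Coord w in 𝓝 a, edist b.1.1 a.1.1 < δ :=
    (continuous_fst.comp continuous_fst).continuousAt.eventually
      (Metric.eball_mem_nhds (a.1.1) hδ')
  have n2 : ∀ᶠ b : Coord w in 𝓝 a, ∀ p, edist (b.1.2 p) (a.1.2 p) < δ := by
    rw [eventually_all]
    exact fun p => ((continuous_apply p).comp
      (continuous_snd.comp continuous_fst)).continuousAt.eventually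
      (Metric.eball_mem_nhds (a.1.2 p) hδ')
  have n3 : ∀ᶠ b : Coord w in 𝓝 a, ∀ v, edist (b.2 v) (a.2 v) < δ := by
    rw [eventually_all]
    exact fun v => ((continuous_apply v).comp continuous_snd).continuousAt.eventually
      (Metric.eball_mem_nhds (a.2 v) hδ')
  filter_upwards [n1, n2, n3] with b h1 h2 h3
  refine (Yw.edist_le c fun v => ?_).trans_lt hδε
  obtain ⟨γ, g0, g1, gl⟩ := hA δ a.1 b.1 (by rwa [edist_comm]) fun p => by
    rw [edist_comm]; exact h2 p
  have hl : LipschitzWith δ fun t : I => AffineMap.lineMap (k := ℝ) (a.2 v) (b.2 v) (t : ℝ) := by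
    have := (lipschitzWith_lineMap (𝕜 := ℝ) (a.2 v) (b.2 v)).comp (LipschitzWith.subtype_val I)
    rw [mul_one] at this
    refine this.weaken ?_
    have h3 := h3 v
    rw [edist_comm, edist_nndist] at h3
    exact_mod_cast h3.le
  have := warpedEDist_le_of_lipschitz (f := warping c v) (a := (ofCoord c a).pt v)
    (b := (ofCoord c b).pt v)
    (γ := fun t => (γ t, AffineMap.lineMap (k := ℝ) (a.2 v) (b.2 v) (t : ℝ)))
    (F := F) (Prod.ext g0 (by simp [ofCoord])) (Prod.ext g1 (by simp [ofCoord])) gl hl fun t => by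
      refine hηF _ (lt_of_le_of_lt ?_ hδη) v
      rw [← g0]
      refine (gl t 0).trans ?_
      rw [ENNReal.coe_mul]
      refine mul_le_of_le_one_right' ?_
      rw [Subtype.edist_eq, edist_dist, Real.dist_eq, Set.Icc.coe_zero, sub_zero,
        abs_of_nonneg t.2.1]
      exact ENNReal.ofReal_le_one.2 t.2.2
  simpa using this

theorem edist_fst_lt_of_edist_lt {a b : Yw c} {ε : ℝ≥0∞} (h : Yw.edist a b < ε)
    (v : InfinitePlace K) :
    edist (a.pt v).1 (b.pt v).1 < ε :=
  (edist_lt_of_warpedEDist_lt (c := 0) (fun y _ => (warping_pos c v y).le)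
    ((Yw.warpedEDist_le_edist c a b v).trans_lt h)).1

theorem continuous_Yw_of_edist {S : Type*} [PseudoEMetricSpace S] {φ : Yw c → S}
    (h : ∀ a, ∀ ε : ℝ≥0∞, 0 < ε → ∃ δ : ℝ≥0∞, 0 < δ ∧
      ∀ b, Yw.edist a b < δ → edist (φ b) (φ a) < ε) : Continuous φ := by
  refine continuous_def.2 fun U hU a ha => ?_
  obtain ⟨ε, hε, hU⟩ := EMetric.isOpen_iff.1 hU _ ha
  obtain ⟨δ, hδ, hb⟩ := h a ε hε
  exact ⟨δ, hδ, fun b hab => hU (hb b hab)⟩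

theorem continuous_Yw_fst (v : InfinitePlace K) : Continuous fun a : Yw c => (a.pt v).1 :=
  continuous_Yw_of_edist c fun a ε hε => ⟨ε, hε, fun b hb => by
    rw [edist_comm]; exact edist_fst_lt_of_edist_lt c hb v⟩

/-- The projection to a component of the Minkowski space is continuous, since the warping function
is locally bounded below by a positive number. -/
theorem continuous_Yw_snd (v : InfinitePlace K) : Continuous fun a : Yw c => (a.pt v).2 := by
  refine continuous_Yw_of_edist c fun a ε hε => ?_
  have hpos := warping_pos c v (a.pt v).1
  obtain ⟨η, hη, hηF⟩ : ∃ η : ℝ≥0∞, 0 < η ∧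
      ∀ x, edist x (a.pt v).1 < η → warping c v (a.pt v).1 / 2 ≤ warping c v x :=
    EMetric.mem_nhds_iff.1 (((continuous_warping c v).tendsto _).eventually_const_le
      (half_lt_self hpos))
  set f₀ := ENNReal.ofReal (warping c v (a.pt v).1 / 2) with hf₀
  have hf₀pos : f₀ ≠ 0 := (ENNReal.ofReal_pos.2 (half_pos hpos)).ne'
  refine ⟨min η (f₀ * ε), lt_min hη (ENNReal.mul_pos hf₀pos hε.ne'), fun b hb => ?_⟩
  have h1 := (edist_lt_of_warpedEDist_lt (f := warping c v) (c := warping c v (a.pt v).1 / 2)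
    (fun y hy => hηF y (by rw [edist_comm]; exact hy.trans_le (min_le_left _ _)))
    ((Yw.warpedEDist_le_edist c a b v).trans_lt hb)).2
  rw [edist_comm]
  exact lt_of_mul_lt_mul_left' (h1.trans_le (min_le_right _ _))

end Topology

/-! ### Coordinates of a component of the Minkowski space -/

section Mink

variable {K : Type*} [Field K]

theorem Mink.affine_apply {v : InfinitePlace K} (x y : K) (z : Mink v) (τ : EmbClass v) :
    (Mink.affine x y z).1 τ = τ.1 y * z.1 τ + τ.1 x := rfl

/-- The coordinates of a point of a component of the Minkowski space have the same norm. -/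
theorem Mink.norm_apply_eq {v : InfinitePlace K} (z : Mink v) (τ τ' : EmbClass v) :
    ‖z.1 τ‖ = ‖z.1 τ'‖ := by
  rcases InfinitePlace.mk_eq_iff.1 (τ.2.trans τ'.2.symm) with h | h
  · rw [Subtype.ext h]
  · rw [z.2 τ τ' h.symm, RCLike.norm_conj]

end Mink

/-! ### Arithmetic of `𝒪_w` -/

section Arithmetic

open WithZero

variable {K : Type*} [Field K] [NumberField K] {w : Kˣ} (c : Choices w)

theorem exists_valuation_yp_self (p : primes w) :
    ∃ m : ℕ, 0 < m ∧ p.1.valuation K (c.yp p : K) = exp (-(m : ℤ)) := by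
  obtain ⟨m, hm, h⟩ := c.yp_spec p
  refine ⟨m, hm, ?_⟩
  have h0 : (c.yp p : K) ≠ 0 := by simpa using yp_ne_zero c p
  have h1 : p.1.valuation K (c.yp p : K) ≤ exp (-(m : ℤ)) := by
    rw [HeightOneSpectrum.valuation_of_algebraMap, HeightOneSpectrum.intValuation_le_pow_iff_dvd, h]
  have h2 : ¬ p.1.valuation K (c.yp p : K) ≤ exp (-((m + 1 : ℕ) : ℤ)) := by
    rw [HeightOneSpectrum.valuation_of_algebraMap, HeightOneSpectrum.intValuation_le_pow_iff_dvd, h,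
      pow_dvd_pow_iff p.1.ne_bot p.1.prime.not_isUnit]
    omega
  rw [valuation_eq_exp_ord p.1 h0, exp_le_exp] at h1 h2
  rw [valuation_eq_exp_ord p.1 h0]
  congr 1
  push_cast at h2
  omega

theorem valuation_yp_of_ne (p : primes w) {q : HeightOneSpectrum (𝓞 K)} (hq : q ≠ p.1) :
    q.valuation K (c.yp p : K) = 1 := by
  rw [HeightOneSpectrum.valuation_eq_one_iff_notMem]
  intro hmem
  obtain ⟨m, hm, h⟩ := c.yp_spec p
  have h1 : p.1.asIdeal ^ m ≤ q.asIdeal := by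
    rw [← h, Ideal.span_singleton_le_iff_mem]; exact hmem
  have h2 : p.1.asIdeal ≤ q.asIdeal := q.isPrime.le_of_pow_le h1
  exact hq (HeightOneSpectrum.ext (p.1.isMaximal.eq_of_le q.isPrime.ne_top h2).symm)

/-- The generator `y_𝔭` of a power of `𝔭` as a unit of `𝒪_w`. -/
def ypUnit (p : primes w) : (Ow w)ˣ where
  val := algebraMap (𝓞 K) (Ow w) (c.yp p)
  inv := ⟨(c.yp p : K)⁻¹, fun q hq => by
    rw [map_inv₀, valuation_yp_of_ne c p (by rintro rfl; exact hq p.2), inv_one]⟩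
  val_inv := Subtype.ext (mul_inv_cancel₀ (by simpa using yp_ne_zero c p))
  inv_val := Subtype.ext (inv_mul_cancel₀ (by simpa using yp_ne_zero c p))

/-- The inclusion of the units of `𝒪_w` in `Kˣ`. -/
def unitVal : (Ow w)ˣ →* Kˣ := Units.map (Ow w).val.toRingHom.toMonoidHom

theorem unitVal_ypUnit (p : primes w) : (unitVal (ypUnit c p) : K) = c.yp p := rfl

theorem unitVal_mem (y : (Ow w)ˣ) : (unitVal y : K) ∈ Ow w := y.1.2

theorem valuation_unitVal (y : (Ow w)ˣ) {q : HeightOneSpectrum (𝓞 K)} (hq : q ∉ primes w) :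
    q.valuation K (unitVal y : K) = 1 := by
  refine le_antisymm (unitVal_mem y q hq) ?_
  have := unitVal_mem y⁻¹ q hq
  rw [map_inv, Units.val_inv_eq_inv_val, map_inv₀] at this
  exact (inv_le_one₀ (zero_lt_iff.2 (by simp))).1 this

/-- The inclusion of `𝒪ˣ` in the unit group of `𝒪_w`. -/
def unitIncl : (𝓞 K)ˣ →* (Ow w)ˣ := Units.map (algebraMap (𝓞 K) (Ow w)).toMonoidHom

theorem unitVal_unitIncl (u : (𝓞 K)ˣ) :
    (unitVal (unitIncl u : (Ow w)ˣ) : K) = ((u : 𝓞 K) : K) := rfl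

theorem valuation_unitIncl (u : (𝓞 K)ˣ) (q : HeightOneSpectrum (𝓞 K)) :
    q.valuation K (unitVal (unitIncl u : (Ow w)ˣ) : K) = 1 := by
  rw [unitVal_unitIncl, HeightOneSpectrum.valuation_eq_one_iff_notMem]
  exact fun h => q.isPrime.ne_top (Ideal.eq_top_of_isUnit_mem _ h u.isUnit)

variable (w) in
/-- The product of the `y_𝔭 ^ k`, a unit of `𝒪_w` that is an element of `𝒪` with large valuations
at all primes in `M_w`. -/
theorem exists_unit_valuation_le (c : Choices w) (k : ℕ) : ∃ (D : (Ow w)ˣ) (d : 𝓞 K),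
    (unitVal D : K) = d ∧ ∀ p : primes w, p.1.valuation K (unitVal D : K) ≤ exp (-(k : ℤ)) := by
  refine ⟨∏ p, ypUnit c p ^ k, ∏ p, c.yp p ^ k, ?_, fun p => ?_⟩
  · simp [unitVal_ypUnit]
  · have : (unitVal (∏ p, ypUnit c p ^ k) : K) = ∏ p, (c.yp p : K) ^ k := by simp [unitVal_ypUnit]
    rw [this, map_prod, Finset.prod_eq_single p]
    · obtain ⟨m, hm, h⟩ := exists_valuation_yp_self c p
      rw [map_pow, h, ← exp_nsmul, exp_le_exp, nsmul_eq_mul]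
      nlinarith
    · intro q _ hq
      rw [map_pow, valuation_yp_of_ne c q (fun h => hq (Subtype.ext h).symm), one_pow]
    · simp

theorem exists_nat_valuation_le {ι : Type*} [Finite ι] (f : ι → ℤᵐ⁰) :
    ∃ n : ℕ, ∀ i, f i ≤ exp (n : ℤ) := by
  obtain ⟨N, hN⟩ := (Set.finite_range fun i => log (f i)).bddAbove
  refine ⟨N.toNat, fun i => ?_⟩
  by_cases h : f i = 0
  · rw [h]; exact zero_le
  · rw [← exp_log h, exp_le_exp]
    exact (hN ⟨i, rfl⟩).trans (Int.self_le_toNat N)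

/-- The diagonal image of `𝒪_w` is dense in the product of the `K_𝔭` over `𝔭 ∈ M_w`. -/
theorem exists_Ow_valuation_sub_le (c : Choices w) (a : primes w → ℤ) (b : primes w → K) :
    ∃ x : Ow w, ∀ p : primes w, p.1.valuation K ((x : K) - b p) ≤ exp (-(a p)) := by
  classical
  obtain ⟨k, hk⟩ := exists_nat_valuation_le fun p : primes w => p.1.valuation K (b p)
  obtain ⟨D, d, -, hD⟩ := exists_unit_valuation_le w c k
  have hD0 : ∀ p : primes w, p.1.valuation K (unitVal D : K) ≠ 0 := fun p => by simp
  obtain ⟨N, hN⟩ := exists_nat_valuation_le fun p : primes w =>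
    (exp (-(a p)) * p.1.valuation K (unitVal D : K))⁻¹
  have hN' : ∀ p : primes w, exp (-(N : ℤ)) ≤ exp (-(a p)) * p.1.valuation K (unitVal D : K) := by
    intro p
    rw [exp_neg]
    exact inv_le_of_inv_le₀ (mul_pos exp_pos (zero_lt_iff.2 (hD0 p))) (hN p)
  have hs : ∀ p : primes w, ∃ s : 𝓞 K,
      p.1.valuation K ((s : K) - unitVal D * b p) ≤ exp (-(N : ℤ)) := by
    intro p
    obtain ⟨s, hs⟩ := p.1.exists_valuation_sub_lt_of_integer (K := K) (x := unitVal D * b p) (by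
      rw [map_mul]
      refine (mul_le_mul' (hD p) (hk p)).trans ?_
      rw [← exp_add]; simp) (Units.mk0 (exp (-(N : ℤ))) exp_ne_zero)
    exact ⟨s, hs.le⟩
  choose s hs using hs
  obtain ⟨y, hy⟩ := exists_forall_sub_mem_ideal (s := (Finset.univ : Finset (primes w)))
    (fun p => p.1.asIdeal) (fun _ => N) (fun p _ => p.1.prime)
    (fun p _ q _ hpq h => hpq (Subtype.ext (HeightOneSpectrum.ext h))) fun p => s p.1
  refine ⟨algebraMap (𝓞 K) (Ow w) y * (D⁻¹ : (Ow w)ˣ), fun p => ?_⟩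
  have e : ((algebraMap (𝓞 K) (Ow w) y * (D⁻¹ : (Ow w)ˣ) : Ow w) : K) =
      (y : K) * (unitVal D : K)⁻¹ := by
    rw [← Units.val_inv_eq_inv_val, ← map_inv]; rfl
  have e2 : (y : K) * (unitVal D : K)⁻¹ - b p = ((y : K) - unitVal D * b p) / (unitVal D : K) := by
    field_simp
  rw [e, e2, map_div₀, div_le_iff₀ (zero_lt_iff.2 (hD0 p))]
  refine le_trans ?_ (hN' p)
  have e3 : (y : K) - unitVal D * b p = ((y - s p : 𝓞 K) : K) + ((s p : K) - unitVal D * b p) := by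
    push_cast; ring
  rw [e3]
  refine Valuation.map_add_le _ ?_ (hs p)
  rw [HeightOneSpectrum.valuation_of_algebraMap, HeightOneSpectrum.intValuation_le_pow_iff_mem]
  exact hy p (Finset.mem_univ p)

/-! ### Finiteness properties of `𝒪_w` and of its unit group -/

/-- A unit of `𝒪_w` with trivial valuations at `M_w` is a unit of `𝒪`, and `α_w` determines its free
part. -/
theorem exists_torsion_of_forall_eq {y : (Ow w)ˣ}
    (hv : ∀ p : primes w, p.1.valuation K (unitVal y : K) = 1) (hα : c.α y = 1) :
    ∃ ζ : Units.torsion K, y = unitIncl (ζ : (𝓞 K)ˣ) := by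
  have hall : ∀ q : HeightOneSpectrum (𝓞 K), q.valuation K (unitVal y : K) = 1 := fun q => by
    by_cases hq : q ∈ primes w
    · exact hv ⟨q, hq⟩
    · exact valuation_unitVal y hq
  obtain ⟨u, hu⟩ := HeightOneSpectrum.mem_integers_of_valuation_le_one (R := 𝓞 K) K (unitVal y : K)
    fun q => (hall q).le
  obtain ⟨u', hu'⟩ := HeightOneSpectrum.mem_integers_of_valuation_le_one (R := 𝓞 K) K
    ((unitVal y)⁻¹ : K) fun q => by rw [map_inv₀, hall q, inv_one]
  let U : (𝓞 K)ˣ := ⟨u, u',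
    RingOfIntegers.ext (by rw [RingOfIntegers.coe_eq_algebraMap, map_mul, hu, hu']; simp),
    RingOfIntegers.ext (by rw [RingOfIntegers.coe_eq_algebraMap, map_mul, hu, hu']; simp)⟩
  have hU : y = unitIncl U := Units.ext (Subtype.ext hu.symm)
  obtain ⟨⟨ζ, k⟩, hζ⟩ := c.e_basis.2 U
  have hζα : c.α (unitIncl (ζ : (𝓞 K)ˣ)) = 1 := by
    have h1 : IsOfFinOrder (ζ : (𝓞 K)ˣ) := (CommGroup.mem_torsion _).1 ζ.2
    exact ((c.α.comp unitIncl).isOfFinOrder h1).eq_one'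
  have hk : k = 0 := by
    have h1 : c.α (unitIncl U) = Multiplicative.ofAdd k := by
      rw [← hζ, map_mul, map_mul, hζα, one_mul, map_prod, map_prod]
      simp only [map_zpow]
      have : ∀ i, c.α (unitIncl (c.e i)) = Multiplicative.ofAdd (Pi.single i 1) := c.α_e
      simp only [this, ← ofAdd_zsmul, ← ofAdd_sum]
      congr 1
      ext j
      simp [Finset.sum_apply, Pi.single_apply]
    rw [← hU, hα] at h1
    exact (Multiplicative.ofAdd.injective h1).symm
  refine ⟨ζ, ?_⟩
  rw [hU, ← hζ, hk]
  simp

/-- Only finitely many units of `𝒪_w` have bounded valuations at `M_w` and bounded `α_w`. -/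
theorem finite_setOf_unit (N : ℤ) :
    {y : (Ow w)ˣ | (∀ p : primes w, |ord p.1 (unitVal y : K)| ≤ N) ∧
      ∀ i, |Multiplicative.toAdd (c.α y) i| ≤ N}.Finite := by
  let F : (Ow w)ˣ → (primes w → ℤ) × (Fin (Units.rank K) → ℤ) := fun y =>
    (fun p => ord p.1 (unitVal y : K), Multiplicative.toAdd (c.α y))
  refine Set.Finite.of_finite_fibers F ?_ ?_
  · refine ((Set.Finite.pi' fun _ => Set.finite_Icc (-N) N).prod
      (Set.Finite.pi' fun _ => Set.finite_Icc (-N) N)).subset ?_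
    rintro _ ⟨y, ⟨h1, h2⟩, rfl⟩
    exact ⟨fun p => abs_le.1 (h1 p), fun i => abs_le.1 (h2 i)⟩
  · rintro _ ⟨y₀, -, rfl⟩
    refine (Set.finite_range fun ζ : Units.torsion K => y₀ * unitIncl (ζ : (𝓞 K)ˣ)).subset ?_
    rintro y ⟨-, hy⟩
    have h1 : ∀ p : primes w, ord p.1 (unitVal y : K) = ord p.1 (unitVal y₀ : K) := fun p =>
      congrFun (congrArg Prod.fst hy) p
    have h2 : c.α y = c.α y₀ := Multiplicative.toAdd.injective (congrArg Prod.snd hy)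
    obtain ⟨ζ, hζ⟩ := exists_torsion_of_forall_eq c (y := y₀⁻¹ * y) (fun p => by
      rw [map_mul, map_inv, Units.val_mul, map_mul, Units.val_inv_eq_inv_val, map_inv₀,
        valuation_eq_exp_ord p.1 (Units.ne_zero (unitVal y)), h1,
        ← valuation_eq_exp_ord p.1 (Units.ne_zero (unitVal y₀))]
      exact inv_mul_cancel₀ (by simp)) (by rw [map_mul, map_inv, h2, inv_mul_cancel])
    exact ⟨ζ, by simp [← hζ]⟩

/-- Only finitely many elements of `𝒪_w` have bounded valuations at `M_w` and at the infinite
places. -/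
theorem finite_setOf_Ow (c : Choices w) (N : ℕ) (B : ℝ) :
    {x : Ow w | (∀ p : primes w, p.1.valuation K (x : K) ≤ exp (N : ℤ)) ∧
      ∀ v : InfinitePlace K, v (x : K) ≤ B}.Finite := by
  obtain ⟨D, d, hd, hD⟩ := exists_unit_valuation_le w c N
  obtain ⟨B', hB'⟩ := (Set.finite_range fun v : InfinitePlace K => v (d : K) * B).bddAbove
  have hd0 : (d : K) ≠ 0 := hd ▸ (unitVal D).ne_zero
  refine Set.Finite.of_finite_image (f := fun x : Ow w => (d : K) * x)
    ((Embeddings.finite_of_norm_le K ℂ B').subset ?_) fun x _ x' _ h =>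
      Subtype.ext (mul_left_cancel₀ hd0 h)
  rintro _ ⟨x, ⟨h1, h2⟩, rfl⟩
  refine ⟨?_, fun τ => ?_⟩
  · obtain ⟨u, hu⟩ := HeightOneSpectrum.mem_integers_of_valuation_le_one (R := 𝓞 K) K
      ((d : K) * x) fun q => by
        rw [map_mul]
        by_cases hq : q ∈ primes w
        · rw [← hd]
          refine (mul_le_mul' (hD ⟨q, hq⟩) (h1 ⟨q, hq⟩)).trans ?_
          rw [← exp_add]; simp
        · exact mul_le_one' (q.valuation_le_one d) (x.2 q hq)
    simp only [← hu]
    exact RingOfIntegers.isIntegral_coe u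
  · rw [map_mul, norm_mul]
    have h3 := hB' ⟨InfinitePlace.mk τ, rfl⟩
    refine le_trans ?_ h3
    have := h2 (InfinitePlace.mk τ)
    rw [InfinitePlace.apply] at this
    simp only [InfinitePlace.apply]
    gcongr

/-! ### The ring of integers is cocompact in the Minkowski space -/

theorem Mink.norm_le {v : InfinitePlace K} {z : Mink v} {R : ℝ} (h : ∀ τ, ‖z.1 τ‖ ≤ R) :
    ‖z‖ ≤ Fintype.card (EmbClass v) * R := by
  have hR : 0 ≤ R := (norm_nonneg _).trans (h ⟨v.embedding, v.mk_embedding⟩)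
  change ‖z.1‖ ≤ _
  refine abs_le_of_sq_le_sq' ?_ (by positivity) |>.2
  rw [EuclideanSpace.norm_sq_eq, mul_pow]
  refine (Finset.sum_le_sum fun τ _ => pow_le_pow_left₀ (norm_nonneg _) (h τ) 2).trans ?_
  rw [Finset.sum_const, Finset.card_univ, nsmul_eq_mul]
  gcongr
  exact_mod_cast Nat.le_self_pow two_ne_zero _

theorem Mink.norm_apply_le {v : InfinitePlace K} (z : Mink v) (τ : EmbClass v) :
    ‖z.1 τ‖ ≤ ‖z‖ := PiLp.norm_apply_le z.1 τ

open mixedEmbedding in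
variable (K) in
/-- The translations by algebraic integers move every point of the Minkowski space into a fixed
bounded set. -/
theorem exists_integer_affine_norm_le : ∃ R : ℝ, ∀ z : ∀ v : InfinitePlace K, Mink v,
    ∃ x : 𝓞 K, ∀ v, ‖Mink.affine (x : K) 1 (z v)‖ ≤ R := by
  classical
  have hR : ∀ z : ∀ v : InfinitePlace K, Mink v, ∃ x : 𝓞 K, ∀ v τ,
      ‖(Mink.affine (x : K) 1 (z v)).1 τ‖ ≤ ∑ i, ‖latticeBasis K i‖ := by
    intro z
    let τ₀ : ∀ v : InfinitePlace K, EmbClass v := fun v => ⟨v.embedding, v.mk_embedding⟩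
    let m : mixedSpace K := (fun v => ((z v.1).1 (τ₀ v.1)).re, fun v => (z v.1).1 (τ₀ v.1))
    obtain ⟨x, hx⟩ := (mem_span_latticeBasis K).1 (ZSpan.floor (latticeBasis K) m).2
    replace hx : mixedEmbedding K (x : K) = ZSpan.floor (latticeBasis K) m := hx
    refine ⟨-x, fun v τ => ?_⟩
    have hle := ZSpan.norm_fract_le (latticeBasis K) m
    rw [ZSpan.fract_apply, ← hx] at hle
    refine le_trans ?_ hle
    rw [Mink.norm_apply_eq _ τ (τ₀ v), Mink.affine_apply, map_one, one_mul,
      show ((-x : 𝓞 K) : K) = -(x : K) from map_neg (algebraMap (𝓞 K) K) x, map_neg,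
      ← sub_eq_add_neg]
    rcases v.isReal_or_isComplex with hv | hv
    · refine le_trans ?_ ((norm_le_pi_norm _ ⟨v, hv⟩).trans (norm_fst_le _))
      have h1 : (((z v).1 (τ₀ v)).re : ℂ) = (z v).1 (τ₀ v) := by
        refine Complex.conj_eq_iff_re.1 ((z v).2 (τ₀ v) (τ₀ v) ?_).symm
        exact (InfinitePlace.conjugate_embedding_eq_of_isReal hv).symm
      have h2 : v.embedding (x : K) = (mixedEmbedding K (x : K)).1 ⟨v, hv⟩ := by
        rw [mixedEmbedding_apply_isReal, InfinitePlace.embedding_of_isReal_apply]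
      rw [← h1]
      change ‖(_ : ℂ) - v.embedding (x : K)‖ ≤ ‖((z v).1 (τ₀ v)).re -
        (mixedEmbedding K (x : K)).1 ⟨v, hv⟩‖
      rw [h2, ← Complex.ofReal_sub, Complex.norm_real]
    · refine le_trans ?_ ((norm_le_pi_norm _ ⟨v, hv⟩).trans (norm_snd_le _))
      exact le_rfl
  refine ⟨∑ v : InfinitePlace K, Fintype.card (EmbClass v) * ∑ i, ‖latticeBasis K i‖, fun z => ?_⟩
  obtain ⟨x, hx⟩ := hR z
  refine ⟨x, fun v => (Mink.norm_le (hx v)).trans ?_⟩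
  exact Finset.single_le_sum (f := fun v : InfinitePlace K =>
    (Fintype.card (EmbClass v) : ℝ) * ∑ i, ‖latticeBasis K i‖)
    (fun v _ => by positivity) (Finset.mem_univ v)

end Arithmetic

/-! ### The action on `Y_w` is cocompact and proper -/

section Action

open WithZero Realization

variable {K : Type*} [Field K] [NumberField K] {w : Kˣ} (c : Choices w)

/-- The translation by `x ∈ 𝒪_w` as an element of `𝒪_w ⋊ 𝒪_wˣ`. -/
def translation (x : Ow w) : Gw w := ⟨Multiplicative.ofAdd x, 1⟩

/-- The multiplication by `y ∈ 𝒪_wˣ` as an element of `𝒪_w ⋊ 𝒪_wˣ`. -/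
def dilation (y : (Ow w)ˣ) : Gw w := ⟨1, y⟩

theorem ord_one (p : HeightOneSpectrum (𝓞 K)) : ord p (1 : K) = 0 := by simp [ord]

theorem translation_smul_treePoint (p : HeightOneSpectrum (𝓞 K)) (x : Ow w) (a : ℤ) (b : K)
    (t : I) : translation x • treePoint p a b t = treePoint p a (b + x) t := by
  have hx : (translation x).x = (x : K) := rfl
  have hy : (translation x).y = 1 := map_one _
  rw [smul_treePoint, hx, hy, Units.val_one, ord_one, add_zero, one_mul]

theorem dilation_smul_treePoint (p : HeightOneSpectrum (𝓞 K)) (y : (Ow w)ˣ) (a : ℤ) (t : I) :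
    dilation y • treePoint p a 0 t = treePoint p (a + ord p (unitVal y : K)) 0 t := by
  have hx : (dilation y).x = 0 := rfl
  have hy : (dilation y).y = unitVal y := rfl
  rw [smul_treePoint, hx, hy, mul_zero, add_zero]

theorem smul_ofCoord (g : Gw w) (a : Coord w) :
    g • ofCoord c a = ofCoord c ((WithLp.toLp 2 fun i =>
      ((Multiplicative.toAdd (c.α g.right) i : ℤ) : ℝ) + a.1.1 i, fun p => g • a.1.2 p),
      fun v => g • a.2 v) := rfl

/-- There is a unit of `𝒪_w` that moves prescribed integers at the primes of `M_w` into the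
intervals `[-v(y_𝔭), -1]`, and prescribed real numbers into the interval `[0, 1]`. -/
theorem exists_unit_reduction (A : primes w → ℤ) (r : Fin (Units.rank K) → ℝ) :
    ∃ y : (Ow w)ˣ, (∀ p, A p + ord p.1 (unitVal y : K) ∈
        Set.Icc (-ord p.1 (c.yp p : K)) (-1)) ∧
      ∀ i, ((Multiplicative.toAdd (c.α y) i : ℤ) : ℝ) + r i ∈ Set.Icc (0 : ℝ) 1 := by
  classical
  set m : primes w → ℤ := fun p => ord p.1 (c.yp p : K)
  have hmval : ∀ p : primes w, p.1.valuation K (c.yp p : K) = exp (-(m p)) := fun p =>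
    valuation_eq_exp_ord p.1 (by simpa using yp_ne_zero c p)
  have hmpos : ∀ p, 0 < m p := fun p => by
    obtain ⟨n, hn, h⟩ := exists_valuation_yp_self c p
    rw [hmval, exp_inj] at h
    omega
  -- With this exponent `A p` is moved to `A p % m p - m p`.
  let y₁ : (Ow w)ˣ := ∏ p, ypUnit c p ^ (-(A p / m p) - 1)
  let l : Fin (Units.rank K) → ℤ := fun i => -⌊((Multiplicative.toAdd (c.α y₁) i : ℤ) : ℝ) + r i⌋
  refine ⟨y₁ * unitIncl (∏ i, c.e i ^ l i), fun p => ?_, fun i => ?_⟩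
  · have h1 : p.1.valuation K (unitVal (y₁ * unitIncl (∏ i, c.e i ^ l i)) : K) =
        exp (-(m p * (-(A p / m p) - 1))) := by
      have : (unitVal y₁ : K) = ∏ p, (c.yp p : K) ^ (-(A p / m p) - 1) := by
        simp [y₁, unitVal_ypUnit]
      rw [map_mul, Units.val_mul, map_mul, valuation_unitIncl, mul_one, this, map_prod,
        Finset.prod_eq_single p]
      · rw [map_zpow₀, hmval, ← exp_zsmul]
        congr 1
        rw [smul_eq_mul]; ring
      · intro q _ hq
        rw [map_zpow₀, valuation_yp_of_ne c q (fun h => hq (Subtype.ext h).symm), one_zpow]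
      · simp
    have h1' : ord p.1 (unitVal (y₁ * unitIncl (∏ i, c.e i ^ l i)) : K) =
        m p * (-(A p / m p) - 1) := by rw [ord, h1, log_exp, neg_neg]
    rw [h1']
    change _ ∈ Set.Icc (-m p) (-1)
    have h2 := Int.emod_add_mul_ediv (A p) (m p)
    have h3 := Int.emod_nonneg (A p) (hmpos p).ne'
    have h4 := Int.emod_lt_of_pos (A p) (hmpos p)
    rw [Set.mem_Icc]
    constructor <;> nlinarith
  · have h1 : c.α (unitIncl (∏ i, c.e i ^ l i)) = Multiplicative.ofAdd l := by
      have : ∀ i, c.α (unitIncl (c.e i)) = Multiplicative.ofAdd (Pi.single i 1) := c.α_e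
      simp only [map_prod, map_zpow, this, ← ofAdd_zsmul, ← ofAdd_sum]
      congr 1
      ext j
      simp [Finset.sum_apply, Pi.single_apply]
    rw [map_mul, h1, toAdd_mul, toAdd_ofAdd, Pi.add_apply, Int.cast_add]
    have h2 := Int.floor_le (((Multiplicative.toAdd (c.α y₁) i : ℤ) : ℝ) + r i)
    have h3 := Int.lt_floor_add_one (((Multiplicative.toAdd (c.α y₁) i : ℤ) : ℝ) + r i)
    have h4 : (l i : ℝ) = -(⌊((Multiplicative.toAdd (c.α y₁) i : ℤ) : ℝ) + r i⌋ : ℝ) := by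
      simp [l]
    rw [h4, Set.mem_Icc]
    constructor <;> linarith

theorem exists_isCompact_iUnion_smul_eq_univ :
    ∃ C : Set (Yw c), IsCompact C ∧ (⋃ g : Gw w, g • C) = Set.univ := by
  obtain ⟨R, hR⟩ := exists_integer_affine_norm_le K
  let S : Set (Coord w) :=
    ((WithLp.toLp 2 '' Set.univ.pi fun _ => Set.Icc (0 : ℝ) 1) ×ˢ
      Set.univ.pi fun p : primes w =>
        ⋃ a ∈ Set.Icc (-ord p.1 (c.yp p : K)) (-1), Set.range (treePoint p.1 a 0)) ×ˢ
      Set.univ.pi fun v => Metric.closedBall (0 : Mink v) R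
  have hS : IsCompact S := by
    refine IsCompact.prod (IsCompact.prod ?_ ?_) ?_
    · exact (isCompact_univ_pi fun _ => isCompact_Icc).image (PiLp.continuous_toLp 2 _)
    · exact isCompact_univ_pi fun p => (Set.finite_Icc _ _).isCompact_biUnion fun a _ =>
        isCompact_range (continuous_treePoint a 0)
    · exact isCompact_univ_pi fun v => isCompact_closedBall _ _
  refine ⟨ofCoord c '' S, hS.image (continuous_ofCoord c), Set.eq_univ_of_forall fun b => ?_⟩
  suffices h : ∃ g : Gw w, g • b ∈ ofCoord c '' S by
    obtain ⟨g, hg⟩ := h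
    exact Set.mem_iUnion.2 ⟨g⁻¹, Set.mem_smul_set.2 ⟨_, hg, inv_smul_smul g b⟩⟩
  obtain ⟨⟨⟨r, q⟩, z⟩, rfl⟩ := ofCoord_surjective c b
  choose A B t hq using fun p : primes w => exists_eq_treePoint (q p)
  -- The translation by `x₁` moves all `q_𝔭` to the lines with `b = 0`.
  obtain ⟨x₁, hx₁⟩ := exists_Ow_valuation_sub_le c (fun p => A p + 1) fun p => -B p
  obtain ⟨y, hyA, hyr⟩ := exists_unit_reduction c A r
  obtain ⟨x, hx⟩ := hR fun v => dilation y • translation x₁ • z v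
  refine ⟨translation (algebraMap (𝓞 K) (Ow w) x) * dilation y * translation x₁, ?_⟩
  rw [smul_ofCoord]
  refine ⟨_, ⟨⟨?_, ?_⟩, ?_⟩, rfl⟩
  · refine ⟨_, fun i _ => ?_, rfl⟩
    have : (translation (algebraMap (𝓞 K) (Ow w) x) * dilation y * translation x₁).right = y := by
      simp [translation, dilation]
    simp only [this]
    exact hyr i
  · intro p _
    simp only [mul_smul]
    have h1 : treePoint p.1 (A p) (B p + x₁) (t p) = treePoint p.1 (A p) 0 (t p) := by
      refine treePoint_eq_of_le ?_ _
      have := hx₁ p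
      rwa [sub_neg_eq_add, add_comm, ← sub_zero (B p + (x₁ : K))] at this
    rw [hq, translation_smul_treePoint, h1, dilation_smul_treePoint, translation_smul_treePoint,
      zero_add]
    refine Set.mem_biUnion (hyA p) ⟨t p, ?_⟩
    refine treePoint_eq_of_le ?_ _
    rw [Valuation.map_sub_swap, sub_zero]
    refine (p.1.valuation_le_one x).trans ?_
    rw [← exp_zero, exp_le_exp]
    have := (hyA p).2
    omega
  · intro v _
    rw [mem_closedBall_zero_iff]
    simp only [mul_smul]
    have hy : (translation (algebraMap (𝓞 K) (Ow w) x)).y = 1 := map_one _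
    have := hx v
    rw [← Units.val_one, ← hy] at this
    exact this

/-- The class of the lattice `𝒪_𝔭 ⊕ 𝒪_𝔭` as a point of the tree. -/
def basePoint (p : HeightOneSpectrum (𝓞 K)) : Tree p := vertex (treeGraph p) (normalClass p 0 0)

theorem edist_smul_basePoint_le {p : HeightOneSpectrum (𝓞 K)} {g : Gw w} {q : Tree p} {N : ℕ}
    (h1 : (edist q (basePoint p)).toReal ≤ N) (h2 : (edist (g • q) (basePoint p)).toReal ≤ N) :
    edist (g • basePoint p) (basePoint p) ≤ ENNReal.ofReal (2 * N) := by
  refine (edist_triangle_left _ _ (g • q)).trans ?_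
  rw [two_mul, ENNReal.ofReal_add (by positivity) (by positivity)]
  exact add_le_add ((edist_smul_tree_le g _ _).trans
    (ENNReal.le_ofReal_iff_toReal_le (edist_tree_ne_top _ _) (by positivity) |>.2 h1))
    (ENNReal.le_ofReal_iff_toReal_le (edist_tree_ne_top _ _) (by positivity) |>.2 h2)

theorem smul_basePoint {p : HeightOneSpectrum (𝓞 K)} (g : Gw w) :
    g • basePoint p = vertex (treeGraph p) (normalClass p (ord p (g.y : K)) g.x) := by
  rw [basePoint, smul_vertex_normalClass, zero_add, mul_zero, zero_add]

theorem abs_ord_le_of_edist_le {p : HeightOneSpectrum (𝓞 K)} {g : Gw w} {N : ℕ}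
    (h : edist (g • basePoint p) (basePoint p) ≤ ENNReal.ofReal (2 * N)) :
    |ord p (g.y : K)| ≤ 2 * N := by
  have h1 := (ofReal_abs_affineExt_sub_le (G := treeGraph p) (h := fun c => (height c : ℝ))
    (fun _ _ h => abs_height_sub_le h) _ _).trans h
  rw [smul_basePoint, basePoint, affineExt_vertex, affineExt_vertex, height_normalClass,
    height_normalClass, ENNReal.ofReal_le_ofReal_iff (by positivity)] at h1
  rw [Int.cast_zero, sub_zero] at h1
  exact_mod_cast h1

theorem valuation_le_of_edist_le {p : HeightOneSpectrum (𝓞 K)} {g : Gw w} {N : ℕ}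
    (h : edist (g • basePoint p) (basePoint p) ≤ ENNReal.ofReal (2 * N)) :
    p.valuation K g.x ≤ exp ((2 * N : ℕ) : ℤ) := by
  have h1 := (ofReal_abs_affineExt_sub_le (G := treeGraph p) (h := fun c => (depth c : ℝ))
    (fun _ _ h => abs_depth_sub_le h) _ _).trans h
  rw [smul_basePoint, basePoint, affineExt_vertex, affineExt_vertex, depth_normalClass,
    depth_normalClass, ENNReal.ofReal_le_ofReal_iff (by positivity)] at h1
  have h0 : log (max (exp (-0 : ℤ)) (p.valuation K (0 : K))) = 0 := by simp
  rw [h0, Int.cast_zero, sub_zero] at h1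
  have h2 : log (max (exp (-ord p (g.y : K))) (p.valuation K g.x)) ≤ ((2 * N : ℕ) : ℤ) := by
    have := (le_abs_self _).trans h1
    exact_mod_cast this
  refine (le_max_right (exp (-ord p (g.y : K))) _).trans ?_
  rwa [← exp_le_exp, exp_log (lt_of_lt_of_le exp_pos (le_max_left _ _)).ne'] at h2

theorem exists_nat_bound {S ι : Type*} [TopologicalSpace S] [Finite ι] {C : Set S}
    (hC : IsCompact C) {φ : ι → S → ℝ} (hφ : ∀ i, Continuous (φ i)) :
    ∃ N : ℕ, ∀ i, ∀ s ∈ C, ‖φ i s‖ ≤ N := by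
  choose B hB using fun i => hC.exists_bound_of_continuousOn (hφ i).continuousOn
  obtain ⟨M, hM⟩ := (Set.finite_range B).bddAbove
  exact ⟨⌈M⌉₊, fun i s hs => (hB i s hs).trans ((hM ⟨i, rfl⟩).trans (Nat.le_ceil M))⟩

theorem finite_setOf_inter_smul_nonempty {C₁ C₂ : Set (Yw c)} (hC₁ : IsCompact C₁)
    (hC₂ : IsCompact C₂) : {g : Gw w | (C₁ ∩ g • C₂).Nonempty}.Finite := by
  obtain ⟨v₀⟩ : Nonempty (InfinitePlace K) := inferInstance
  have hC := hC₁.union hC₂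
  obtain ⟨N₁, hN₁⟩ := exists_nat_bound hC (φ := fun i b => (b.pt v₀).1.fst i) fun i =>
    (PiLp.continuous_apply 2 _ i).comp
      ((WithLp.continuous_fst 2 _ _).comp (continuous_Yw_fst c v₀))
  obtain ⟨N₂, hN₂⟩ := exists_nat_bound hC
    (φ := fun p b => (edist ((b.pt v₀).1.snd p) (basePoint p.1)).toReal) fun p =>
    ENNReal.continuousOn_toReal.comp_continuous
      (((PiLp.continuous_apply 2 _ p).comp
        ((WithLp.continuous_snd 2 _ _).comp (continuous_Yw_fst c v₀))).edist continuous_const)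
      fun b => edist_tree_ne_top _ _
  obtain ⟨N₃, hN₃⟩ := exists_nat_bound hC (φ := fun v b => ‖(b.pt v).2‖) fun v =>
    (continuous_Yw_snd c v).norm
  have key : ∀ g : Gw w, (C₁ ∩ g • C₂).Nonempty →
      (∀ p : primes w, edist (g • basePoint p.1) (basePoint p.1) ≤ ENNReal.ofReal (2 * N₂)) ∧
      (∀ i, |Multiplicative.toAdd (c.α g.right) i| ≤ 2 * N₁) ∧
      ∀ v : InfinitePlace K, v g.x ≤ N₃ + v (g.y : K) * N₃ := by
    rintro g ⟨_, hb₁, b, hb₂, rfl⟩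
    replace hb₁ : g • b ∈ C₁ ∪ C₂ := Or.inl hb₁
    replace hb₂ : b ∈ C₁ ∪ C₂ := Or.inr hb₂
    refine ⟨fun p => ?_, fun i => ?_, fun v => ?_⟩
    · have h1 := (le_abs_self _).trans (hN₂ p _ hb₁)
      have h2 := (le_abs_self _).trans (hN₂ p _ hb₂)
      exact edist_smul_basePoint_le h2 h1
    · have h1 := abs_le.1 (hN₁ i _ hb₁)
      have h2 := abs_le.1 (hN₁ i _ hb₂)
      have h3 : ((g • b).pt v₀).1.fst i =
        ((Multiplicative.toAdd (c.α g.right) i : ℤ) : ℝ) + (b.pt v₀).1.fst i := rfl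
      rw [h3] at h1
      have : |((Multiplicative.toAdd (c.α g.right) i : ℤ) : ℝ)| ≤ 2 * N₁ := by
        rw [abs_le]; constructor <;> linarith
      exact_mod_cast this
    · let τ : EmbClass v := ⟨v.embedding, v.mk_embedding⟩
      have h1 := hN₃ v _ hb₁
      have h2 := hN₃ v _ hb₂
      rw [norm_norm] at h1 h2
      replace h1 := (Mink.norm_apply_le _ τ).trans h1
      replace h2 := (Mink.norm_apply_le _ τ).trans h2
      have h3 : ((g • b).pt v).2.1 τ = τ.1 (g.y : K) * (b.pt v).2.1 τ + τ.1 g.x := rfl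
      rw [← InfinitePlace.norm_embedding_eq v g.x, ← InfinitePlace.norm_embedding_eq v (g.y : K)]
      have h4 : v.embedding g.x =
          ((g • b).pt v).2.1 τ - v.embedding (g.y : K) * (b.pt v).2.1 τ := by
        rw [h3]; ring
      rw [h4]
      refine (norm_sub_le _ _).trans (add_le_add h1 ?_)
      rw [norm_mul]
      gcongr
  refine Set.Finite.of_finite_fibers (fun g : Gw w => g.right) ?_ ?_
  · refine (finite_setOf_unit c (max (2 * N₁) (2 * N₂))).subset ?_
    rintro _ ⟨g, hg, rfl⟩
    obtain ⟨h1, h2, -⟩ := key g hg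
    exact ⟨fun p => (abs_ord_le_of_edist_le (h1 p)).trans (le_max_right _ _),
      fun i => (h2 i).trans (le_max_left _ _)⟩
  · rintro _ ⟨g₀, -, rfl⟩
    refine Set.Finite.of_finite_image (f := fun g : Gw w => Multiplicative.toAdd g.left)
      ((finite_setOf_Ow c (2 * N₂)
        (N₃ + (∑ v : InfinitePlace K, v (g₀.y : K)) * N₃)).subset ?_) ?_
    · rintro _ ⟨g, ⟨hg, hgr⟩, rfl⟩
      obtain ⟨h1, -, h3⟩ := key g hg
      refine ⟨fun p => valuation_le_of_edist_le (h1 p), fun v => (h3 v).trans ?_⟩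
      have hy : g.y = g₀.y := congrArg unitVal hgr
      rw [hy]
      gcongr
      exact Finset.single_le_sum (f := fun v : InfinitePlace K => v (g₀.y : K))
        (fun v _ => apply_nonneg v _) (Finset.mem_univ v)
    · rintro g ⟨-, hg⟩ g' ⟨-, hg'⟩ h
      exact SemidirectProduct.ext h (Eq.trans hg (Eq.symm hg'))

end Action

end WarpedAction

end

/-- Let `K = ℚ(w)` be the number field generated by a nonzero algebraic number `w`. Then the action
of `𝒪_w ⋊ 𝒪_wˣ` on `Y_w` is cocompact and proper. -/
theorem mainTheorem12 {K : Type*} [Field K] [NumberField K] (w : Kˣ) (hw : ℚ⟮(w : K)⟯ = ⊤)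
    (c : WarpedAction.Choices w) :
    (∃ C : Set (WarpedAction.Yw c), IsCompact C ∧
      (⋃ g : WarpedAction.Gw w, g • C) = Set.univ) ∧
    ∀ C₁ C₂ : Set (WarpedAction.Yw c), IsCompact C₁ → IsCompact C₂ →
      {g : WarpedAction.Gw w | (C₁ ∩ g • C₂).Nonempty}.Finite := by
  exact ⟨WarpedAction.exists_isCompact_iUnion_smul_eq_univ c, fun _ _ h₁ h₂ =>
    WarpedAction.finite_setOf_inter_smul_nonempty c h₁ h₂⟩
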